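/- Let $\mathcal C\subseteq\mathbb F_2^N$ be a binary linear block code of length $N$ with $M\ge 2$ codewords and rate $R=\frac{\log M}{N}$ (logarithms are natural). Let $S_0=0$ and, for $1\le l\le N$, let $S_l$ be the number of non-zero codewords of Hamming weight $l$. Let $P_N(l)=\frac{S_l}{M-1}$ and $Q_N(l)=2^{-N}\binom{N}{l}$ for $0\le l\le N$. A uniformly chosen codeword is transmitted over a memoryless binary-input channel with transition density $p(y|x)$, $x\in\{0,1\}$, with respect to a $\sigma$-finite reference measure $dy$ on the output space (counting measure for a discrete output alphabet). The channel is assumed to be output-symmetric: some measurable involution of the output space exchanges the output distributions of the inputs $0$ and $1$. For $0\le\rho\le 1$ and a probability vector $q$ on $\{0,1\}$ let $$E_0(\rho,q)=-\log\int\Bigl(\sum_{x\in\{0,1\}}q(x)\,p(y|x)^{\frac1{1+\rho}}\Bigr)^{1+\rho}dy .$$ For $r\ge1$ let $s=s(r)=\frac r{r-1}$ ($s=\infty$ for $r=1$), and let $D_s$ be the Rényi divergence of order $s$, i.e. $D_s(P\|Q)=\frac1{s-1}\log\sum_l P(l)^sQ(l)^{1-s}$ for $1<s<\infty$ and $D_\infty(P\|Q)=\log\max_l\frac{P(l)}{Q(l)}$.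 Then, for every maximum-likelihood decoder, the block error probability $P_{\mathrm e}$ satisfies $$P_{\mathrm e}<\exp\Bigl(-N\,\sup_{r\ge1}\;\max_{0\le\rho'\le1/r}\Bigl[E_0\bigl(\rho',(\tfrac12,\tfrac12)\bigr)-\rho'\Bigl(rR+\frac{D_s(P_N\|Q_N)}{N}\Bigr)\Bigr]\Bigr),$$ where the maxima are attained and the supremum is finite. Moreover $P_{\mathrm e}$ equals the conditional error probability $P_{\mathrm e|0}$ given that the all-zero codeword is sent, provided that ties between codewords of maximal likelihood have probability zero or are resolved uniformly at random. For $r=1$ the maximum over $\rho'$ equals Gallager's random coding exponent $E_{\mathrm r}(R')=\max_{0\le\rho\le1}\max_q\,[E_0(\rho,q)-\rho R']$ at $R'=R+\frac1N\log\max_{0\le l\le N}\frac{P_N(l)}{Q_N(l)}$, so that in particular the Shulman–Feder bound $P_{\mathrm e}<\exp(-N E_{\mathrm r}(R'))$ holds. -/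

import Mathlib

open MeasureTheory Set
open scoped NNReal ENNReal

noncomputable section

namespace LinearCodeBound

/-! ### Binary-input channels -/

/-- A binary-input channel with output space `Y`, given by its transition densities
`p(y|x) = dens x y` with respect to a σ-finite reference measure (a counting measure for a
discrete output alphabet, Lebesgue measure for continuous outputs, ...). -/
structure BinaryChannel (Y : Type*) [MeasurableSpace Y] where
  /-- the reference measure on the output space -/
  ref : Measure Y
  sigmaFinite_ref : SigmaFinite ref
  /-- the transition density `p(y|x)` -/
  dens : ZMod 2 → Y → ℝ≥0
  measurable_dens : ∀ x, Measurable (dens x)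
  lintegral_dens : ∀ x, ∫⁻ y, (dens x y : ℝ≥0∞) ∂ref = 1

namespace BinaryChannel

variable {Y : Type*} [MeasurableSpace Y]

/-- The law of the channel output when the input bit is `x`. -/
def law (ch : BinaryChannel Y) (x : ZMod 2) : Measure Y :=
  ch.ref.withDensity (fun y => (ch.dens x y : ℝ≥0∞))

instance (ch : BinaryChannel Y) (x : ZMod 2) : IsProbabilityMeasure (ch.law x) :=
  ⟨by simp [law, ch.lintegral_dens x]⟩

/-- Output symmetry: some measurable involution of the output space exchanges the output law
of the input `0` with that of the input `1` (for real outputs typically `y ↦ -y`). -/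
def IsOutputSymmetric (ch : BinaryChannel Y) : Prop :=
  ∃ τ : Y → Y, Measurable τ ∧ Function.Involutive τ ∧ ch.law 1 = (ch.law 0).map τ

/-- The channel is used without memory: the law of the output block when `c` is transmitted. -/
def blockLaw (ch : BinaryChannel Y) {N : ℕ} (c : Fin N → ZMod 2) : Measure (Fin N → Y) :=
  Measure.pi (fun i => ch.law (c i))

/-- The likelihood `∏ i, p(y_i|c_i)` of the word `c` given the output block `y`. -/
def likelihood (ch : BinaryChannel Y) {N : ℕ} (y : Fin N → Y) (c : Fin N → ZMod 2) : ℝ≥0 :=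
  ∏ i, ch.dens (c i) (y i)

/-- Gallager's function
`E₀(ρ, q) = - log ∫ (∑ x, q(x) p(y|x)^(1/(1+ρ)))^(1+ρ) dy`. -/
def gallagerE0 (ch : BinaryChannel Y) (ρ : ℝ) (q : ZMod 2 → ℝ) : ℝ :=
  -Real.log (∫ y, (∑ x, q x * (ch.dens x y : ℝ) ^ (1 / (1 + ρ))) ^ (1 + ρ) ∂ch.ref)

end BinaryChannel

/-- The input distribution `(1/2, 1/2)`. -/
def uniformInput : ZMod 2 → ℝ := fun _ => 1 / 2

/-! ### Binary linear block codes of length `N` and their distance spectra -/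

variable {N : ℕ}

open Classical in
/-- The codewords of a binary linear code, as a finite set. -/
def codewords (C : Submodule (ZMod 2) (Fin N → ZMod 2)) : Finset (Fin N → ZMod 2) :=
  Finset.univ.filter (fun c => c ∈ C)

/-- The number `M` of codewords. -/
def codeSize (C : Submodule (ZMod 2) (Fin N → ZMod 2)) : ℕ := (codewords C).card

/-- The rate `log M / N`, in nats. -/
def rate (C : Submodule (ZMod 2) (Fin N → ZMod 2)) : ℝ := Real.log (codeSize C) / N

/-- The number `S_l` of non-zero codewords of Hamming weight `l` (so `S_0 = 0`). -/
def spectrum (C : Submodule (ZMod 2) (Fin N → ZMod 2)) (l : ℕ) : ℕ :=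
  ((codewords C).filter (fun c => c ≠ 0 ∧ hammingNorm c = l)).card

/-- The normalized distance spectrum `P_N(l) = S_l / (M - 1)`, `0 ≤ l ≤ N`. -/
def spectrumPMF (C : Submodule (ZMod 2) (Fin N → ZMod 2)) (l : Fin (N + 1)) : ℝ :=
  (spectrum C l : ℝ) / ((codeSize C : ℝ) - 1)

/-- The binomial distribution `Q_N(l) = 2^(-N) * (N choose l)`, `0 ≤ l ≤ N`. -/
def binomialHalf (N : ℕ) (l : Fin (N + 1)) : ℝ := (N.choose l : ℝ) / 2 ^ N

/-! ### Rényi divergence -/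

open Classical in
/-- The Rényi divergence (in nats) of order `s ∈ [0, ∞]` between two probability mass functions
`P`, `Q` on a finite set, where `Q` is positive everywhere. -/
def renyiDiv {α : Type*} [Fintype α] (s : ℝ≥0∞) (P Q : α → ℝ) : ℝ :=
  if s = ∞ then Real.log (⨆ x, P x / Q x)
  else if s = 0 then Real.log (1 / ∑ x, if P x = 0 then 0 else Q x)
  else if s = 1 then ∑ x, P x * Real.log (P x / Q x)
  else 1 / (s.toReal - 1) * Real.log (∑ x, P x ^ s.toReal * Q x ^ (1 - s.toReal))

open Classical in
/-- The order `s = r / (r - 1)` conjugate to `r ≥ 1`, with `s = ∞` for `r = 1`. -/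
def conjOrder (r : ℝ) : ℝ≥0∞ := if r = 1 then ∞ else ENNReal.ofReal (r / (r - 1))

/-! ### Maximum-likelihood decoding -/

variable {Y : Type*} [MeasurableSpace Y]

/-- `c` is a codeword of maximal likelihood given the output block `y`. -/
def IsMostLikely (ch : BinaryChannel Y) (C : Submodule (ZMod 2) (Fin N → ZMod 2))
    (y : Fin N → Y) (c : Fin N → ZMod 2) : Prop :=
  c ∈ C ∧ ∀ c' ∈ C, ch.likelihood y c' ≤ ch.likelihood y c

/-- `d` is a maximum-likelihood decoder for the code `C`, where `d y c` is the probability that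
the decoder outputs `c` when it observes `y`. The output is always a codeword of maximal
likelihood; ties may be resolved in any (deterministic or randomized) way. -/
structure IsMLDecoder (ch : BinaryChannel Y) (C : Submodule (ZMod 2) (Fin N → ZMod 2))
    (d : (Fin N → Y) → (Fin N → ZMod 2) → ℝ) : Prop where
  measurable : ∀ c, Measurable (fun y => d y c)
  nonneg : ∀ y c, 0 ≤ d y c
  sum_eq_one : ∀ y, ∑ c, d y c = 1
  mostLikely : ∀ y c, d y c ≠ 0 → IsMostLikely ch C y c

/-- Almost surely, for each transmitted codeword, the decoder `d` gives all codewords of maximal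
likelihood the same probability: ties are resolved uniformly at random. (This is automatic for
an ML decoder if ties have probability zero.) -/
def ResolvesTiesUniformly (ch : BinaryChannel Y) (C : Submodule (ZMod 2) (Fin N → ZMod 2))
    (d : (Fin N → Y) → (Fin N → ZMod 2) → ℝ) : Prop :=
  ∀ c ∈ C, ∀ᵐ y ∂ch.blockLaw c, ∀ c₁ c₂,
    IsMostLikely ch C y c₁ → IsMostLikely ch C y c₂ → d y c₁ = d y c₂

/-- The conditional block error probability `P_{e|c}` given that `c` is transmitted. -/
def condErrorProb (ch : BinaryChannel Y) (d : (Fin N → Y) → (Fin N → ZMod 2) → ℝ)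
    (c : Fin N → ZMod 2) : ℝ :=
  ∫ y, (1 - d y c) ∂ch.blockLaw c

/-- The block error probability `P_e`: the codewords are equally likely to be transmitted. -/
def blockErrorProb (ch : BinaryChannel Y) (C : Submodule (ZMod 2) (Fin N → ZMod 2))
    (d : (Fin N → Y) → (Fin N → ZMod 2) → ℝ) : ℝ :=
  (∑ c ∈ codewords C, condErrorProb ch d c) / codeSize C

/-- The exponent `E₀(ρ', (1/2, 1/2)) - ρ' (r R + D_s(P_N ‖ Q_N) / N)` with `s = r / (r - 1)`. -/
def exponent (ch : BinaryChannel Y) (C : Submodule (ZMod 2) (Fin N → ZMod 2)) (r ρ' : ℝ) : ℝ :=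
  ch.gallagerE0 ρ' uniformInput -
    ρ' * (r * rate C + renyiDiv (conjOrder r) (spectrumPMF C) (binomialHalf N) / N)

end LinearCodeBound

end

noncomputable section

namespace LinearCodeBound

section

/-! ### Product measures -/

/-! For a sent word `v`, Gallager's argument bounds the conditional error probability by the
integral of `p(y|v)^t (∑_{w ≠ 0} p(y|w+v)^l)^ρ` whenever `t + l ρ = 1`; here `t = 1/(1+ρ')`, `l =
t/r`, `ρ = r ρ' ≤ 1`. For a memoryless symmetric channel this integral changes neither when `v` runs
through all of `F_2^N` nor when the coordinates of the code are permuted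
(`lintegral_errorIntegrand_eq`). So for one fixed code it equals its average over all `v` and all
permutations.

Concavity of `x ↦ x^ρ` moves the average over permutations inside the power
(`perm_average_rpow_le`). A randomly permuted codeword is uniform on its weight class, so each word
enters with a weight proportional to `P_N/Q_N` at its Hamming weight (`perm_average_eq`). Hölder's
inequality with exponents `s` and `r` (`sum_spectrumRatio_mul_le`) separates this ratio, whose `L^s`
norm is `exp(D_s/r)`, from the likelihoods. What remains is `(2^(-N) ∑_u p(y|u)^t)^(1+ρ')`, which
factors over the coordinates into integrands of `E₀`.

The bound obtained has `(M-1)^(r ρ')` in place of `M^(r ρ')`, and this gap yields strictness. The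
supremum over `r` need not be attained, so the gap must be uniform: the exponent is at most `ρ' log
2`, hence an exponent near a positive supremum keeps `ρ'` away from `0`. If the supremum is not
positive, `P_e < 1` suffices.

Output symmetry constrains only the output laws, so the channel is first redescribed with an
invariant reference measure and densities exchanged pointwise (`exists_isRescaling`). Translation
symmetry also gives `P_e = P_{e|0}`, and convexity in `q` makes the uniform input optimal, which
identifies the case `r = 1`. -/

theorem lintegral_pi_prod {n : ℕ} {E : Type*} [MeasurableSpace E] (μ : Fin n → Measure E)
    [∀ i, SigmaFinite (μ i)] (f : Fin n → E → ℝ≥0∞) (hf : ∀ i, Measurable (f i)) :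
    ∫⁻ x : Fin n → E, ∏ i, f i (x i) ∂(Measure.pi μ) = ∏ i, ∫⁻ x, f i x ∂(μ i) := by
  induction n with
  | zero => simp
  | succ n ih =>
      calc
        _ = ∫⁻ x : E × (Fin n → E), f 0 x.1 * ∏ i : Fin n, f (Fin.succ i) (x.2 i)
            ∂((μ 0).prod (Measure.pi (fun i ↦ μ i.succ))) := by
          rw [← ((measurePreserving_piFinSuccAbove μ 0).symm).lintegral_comp
            (f := fun x => ∏ i, f i (x i))
            (Finset.measurable_prod _ fun i _ => (hf i).comp (measurable_pi_apply i))]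
          simp_rw [MeasurableEquiv.piFinSuccAbove_symm_apply, Fin.insertNthEquiv,
            Fin.prod_univ_succ, Fin.insertNth_zero, Equiv.coe_fn_mk, Fin.cons_succ,
            Fin.zero_succAbove, Fin.cons_zero]
          rfl
        _ = (∫⁻ x, f 0 x ∂μ 0) * ∏ i : Fin n, ∫⁻ x, f (Fin.succ i) x ∂(μ i.succ) := by
          rw [← ih _ _ fun i => hf i.succ, ← lintegral_prod_mul (hf 0).aemeasurable
            (Finset.measurable_prod _ fun i _ =>
              (hf i.succ).comp (measurable_pi_apply i)).aemeasurable]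
        _ = ∏ i, ∫⁻ x, f i x ∂(μ i) := by rw [Fin.prod_univ_succ]

theorem pi_withDensity {n : ℕ} {E : Type*} [MeasurableSpace E] (μ : Fin n → Measure E)
    [∀ i, SigmaFinite (μ i)] (f : Fin n → E → ℝ≥0∞) (hf : ∀ i, Measurable (f i))
    [∀ i, SigmaFinite ((μ i).withDensity (f i))] :
    Measure.pi (fun i => (μ i).withDensity (f i)) =
      (Measure.pi μ).withDensity (fun x => ∏ i, f i (x i)) := by
  refine Measure.pi_eq fun s hs => ?_
  rw [withDensity_apply _ (MeasurableSet.univ_pi hs), Measure.restrict_pi_pi,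
    lintegral_pi_prod _ _ hf]
  exact Finset.prod_congr rfl fun i _ => (withDensity_apply _ (hs i)).symm

variable {Y : Type*} [MeasurableSpace Y] {N : ℕ}

namespace BinaryChannel

instance (ch : BinaryChannel Y) : SigmaFinite ch.ref := ch.sigmaFinite_ref

attribute [fun_prop] BinaryChannel.measurable_dens

/-- The reference measure for output blocks of length `N`. -/
def blockRef (ch : BinaryChannel Y) (N : ℕ) : Measure (Fin N → Y) :=
  Measure.pi fun _ => ch.ref

@[fun_prop]
theorem measurable_likelihood (ch : BinaryChannel Y) (c : Fin N → ZMod 2) :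
    Measurable fun y => ch.likelihood y c :=
  Finset.measurable_prod _ fun i _ => (ch.measurable_dens _).comp (measurable_pi_apply i)

theorem blockLaw_eq_withDensity (ch : BinaryChannel Y) (c : Fin N → ZMod 2) :
    ch.blockLaw c = (ch.blockRef N).withDensity fun y => (ch.likelihood y c : ℝ≥0∞) := by
  have h (i : Fin N) : SigmaFinite (ch.ref.withDensity fun y => (ch.dens (c i) y : ℝ≥0∞)) :=
    inferInstanceAs (SigmaFinite (ch.law (c i)))
  have := pi_withDensity (fun _ : Fin N => ch.ref) (fun i y => (ch.dens (c i) y : ℝ≥0∞))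
    fun i => (ch.measurable_dens _).coe_nnreal_ennreal
  simpa [blockLaw, law, blockRef, likelihood] using this

instance (ch : BinaryChannel Y) (c : Fin N → ZMod 2) : IsProbabilityMeasure (ch.blockLaw c) := by
  unfold blockLaw; infer_instance

end BinaryChannel

end

section

variable {N : ℕ}

/-! ### Weight classes and permutations of the coordinates -/

/-- The Hamming weight, as an element of `Fin (N + 1)`. -/
def weight (u : Fin N → ZMod 2) : Fin (N + 1) :=
  ⟨hammingNorm u, Nat.lt_succ_of_le (by simpa using hammingNorm_le_card_fintype (x := u))⟩

theorem zmod_two_eq_iff (a b : ZMod 2) : a = b ↔ (a ≠ 0 ↔ b ≠ 0) := by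
  revert a b; decide

theorem hammingNorm_comp_perm (u : Fin N → ZMod 2) (σ : Equiv.Perm (Fin N)) :
    hammingNorm (u ∘ σ) = hammingNorm u := by
  unfold hammingNorm
  exact Finset.card_equiv σ (by simp)

/-- A binary word is determined by its support, and a bijection between two supports of equal size
extends to a permutation of the coordinates. -/
theorem exists_perm_of_hammingNorm_eq {u w : Fin N → ZMod 2}
    (h : hammingNorm u = hammingNorm w) : ∃ σ : Equiv.Perm (Fin N), u = w ∘ σ := by
  have hc : Fintype.card {i // u i ≠ 0} = Fintype.card {i // w i ≠ 0} := by
    simpa [hammingNorm, Fintype.card_subtype] using h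
  let e := Fintype.equivOfCardEq hc
  refine ⟨e.extendSubtype, funext fun i => (zmod_two_eq_iff _ _).2 ⟨fun hi => ?_, fun hi => ?_⟩⟩
  · exact e.extendSubtype_mem i hi
  · by_contra hi'
    exact e.extendSubtype_not_mem i (not_not.2 hi') hi

theorem card_weight_eq (l : Fin (N + 1)) :
    (Finset.univ.filter fun u : Fin N → ZMod 2 => weight u = l).card = N.choose l := by
  have : (Finset.powersetCard (l : ℕ) (Finset.univ : Finset (Fin N))).card = N.choose l := by
    simp
  rw [← this]
  refine Finset.card_bij' (fun u _ => Finset.univ.filter fun i => u i ≠ 0)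
    (fun s _ i => if i ∈ s then 1 else 0) ?_ ?_ ?_ ?_
  · intro u hu
    simp only [weight, Fin.ext_iff, Finset.mem_filter, Finset.mem_univ, true_and] at hu
    simpa [Finset.mem_powersetCard, hammingNorm] using hu
  · intro s hs
    simpa [weight, Fin.ext_iff, hammingNorm] using hs
  · intro u _
    funext i
    exact (zmod_two_eq_iff _ _).2 (by simp)
  · intro s _
    ext i
    simp

theorem sum_weight {g : Fin (N + 1) → ℝ} :
    ∑ u : Fin N → ZMod 2, g (weight u) = ∑ l : Fin (N + 1), (N.choose l : ℝ) * g l := by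
  rw [← Finset.sum_fiberwise Finset.univ weight]
  refine Finset.sum_congr rfl fun l _ => ?_
  rw [Finset.sum_congr rfl (g := fun _ => g l) fun u hu => by
    rw [(Finset.mem_filter.1 hu).2], Finset.sum_const, card_weight_eq, nsmul_eq_mul]

theorem choose_weight_pos (l : Fin (N + 1)) : 0 < (N.choose l : ℝ) := by
  exact_mod_cast Nat.choose_pos (Nat.lt_succ_iff.1 l.2)

/-- Double counting of `φ (u ∘ σ)` over `σ` and over `u` in the weight class of `w`. Permutations
act transitively on the class, so the sum over `σ` is the same for every such `u` (`hconst`); each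
single `σ` permutes the class (`hclass`). -/
theorem sum_perm_comp (w : Fin N → ZMod 2) (φ : (Fin N → ZMod 2) → ℝ) :
    (∑ σ : Equiv.Perm (Fin N), φ (w ∘ σ)) / N.factorial =
      ∑ u : Fin N → ZMod 2, if weight u = weight w then φ u / N.choose (weight u) else 0 := by
  have hconst (u : Fin N → ZMod 2) (hu : weight u = weight w) :
      ∑ σ : Equiv.Perm (Fin N), φ (u ∘ σ) = ∑ σ : Equiv.Perm (Fin N), φ (w ∘ σ) := by
    obtain ⟨τ, rfl⟩ := exists_perm_of_hammingNorm_eq (Fin.ext_iff.1 hu)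
    exact Equiv.sum_comp (Equiv.mulLeft τ) fun σ : Equiv.Perm (Fin N) => φ (w ∘ σ)
  have hclass (σ : Equiv.Perm (Fin N)) :
      ∑ u : Fin N → ZMod 2, (if weight u = weight w then φ (u ∘ σ) else 0) =
        ∑ u : Fin N → ZMod 2, if weight u = weight w then φ u else 0 := by
    rw [← (Equiv.arrowCongr σ.symm (Equiv.refl (ZMod 2))).sum_comp
      (fun u => if weight u = weight w then φ u else 0)]
    refine Finset.sum_congr rfl fun u _ => ?_
    have h1 : (Equiv.arrowCongr σ.symm (Equiv.refl (ZMod 2))) u = u ∘ σ := by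
      ext i; simp [Equiv.arrowCongr]
    have h2 : weight (u ∘ σ) = weight u := Fin.ext (hammingNorm_comp_perm u σ)
    rw [h1, h2]
  have hdouble : (N.choose (weight w) : ℝ) * ∑ σ : Equiv.Perm (Fin N), φ (w ∘ σ) =
      N.factorial * ∑ u : Fin N → ZMod 2, if weight u = weight w then φ u else 0 := by
    calc
      _ = ∑ u : Fin N → ZMod 2, if weight u = weight w then
            ∑ σ : Equiv.Perm (Fin N), φ (u ∘ σ) else 0 := by
        rw [← Finset.sum_filter, Finset.sum_congr rfl fun u hu =>
          hconst u (Finset.mem_filter.1 hu).2, Finset.sum_const, card_weight_eq, nsmul_eq_mul]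
      _ = ∑ σ : Equiv.Perm (Fin N), ∑ u : Fin N → ZMod 2,
            if weight u = weight w then φ (u ∘ σ) else 0 := by
        rw [Finset.sum_comm]
        refine Finset.sum_congr rfl fun u _ => ?_
        split_ifs <;> simp
      _ = _ := by
        rw [Finset.sum_congr rfl fun σ _ => hclass σ, Finset.sum_const, nsmul_eq_mul,
          Finset.card_univ, Fintype.card_perm, Fintype.card_fin]
  have h3 : (∑ u : Fin N → ZMod 2,
      if weight u = weight w then φ u / (N.choose (weight u) : ℝ) else 0) =
      (∑ u : Fin N → ZMod 2, if weight u = weight w then φ u else 0) / N.choose (weight w) := by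
    rw [Finset.sum_div]
    refine Finset.sum_congr rfl fun u _ => ?_
    split_ifs with h
    · rw [h]
    · simp
  have hf : (N.factorial : ℝ) ≠ 0 := by exact_mod_cast N.factorial_ne_zero
  rw [h3, div_eq_div_iff hf (choose_weight_pos _).ne']
  linarith

/-! ### The distance spectrum -/

variable {C : Submodule (ZMod 2) (Fin N → ZMod 2)}

theorem mem_codewords {c : Fin N → ZMod 2} : c ∈ codewords C ↔ c ∈ C := by
  simp [codewords]

theorem zero_mem_codewords : (0 : Fin N → ZMod 2) ∈ codewords C := mem_codewords.2 C.zero_mem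

theorem two_le_codeSize (hC : C ≠ ⊥) : 2 ≤ codeSize C := by
  obtain ⟨x, hx, hx0⟩ := (Submodule.ne_bot_iff C).1 hC
  exact Finset.one_lt_card.2 ⟨x, mem_codewords.2 hx, 0, zero_mem_codewords, hx0⟩

theorem codeSize_sub_one_pos (hC : C ≠ ⊥) : 0 < (codeSize C : ℝ) - 1 := by
  have : (2 : ℝ) ≤ codeSize C := by exact_mod_cast two_le_codeSize hC
  linarith

theorem length_pos (hC : C ≠ ⊥) : 0 < N := by
  rcases Nat.eq_zero_or_pos N with rfl | h
  · exact absurd (Subsingleton.elim C ⊥) hC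
  · exact h

theorem spectrum_eq (C : Submodule (ZMod 2) (Fin N → ZMod 2)) (l : Fin (N + 1)) :
    (spectrum C l : ℝ) = ∑ w ∈ (codewords C).erase 0, if l = weight w then 1 else 0 := by
  rw [Finset.sum_boole, spectrum]
  congr 2
  ext c
  simp only [Finset.mem_filter, Finset.mem_erase, weight, Fin.ext_iff]
  tauto

theorem card_codewords_erase (C : Submodule (ZMod 2) (Fin N → ZMod 2)) :
    (((codewords C).erase 0).card : ℝ) = (codeSize C : ℝ) - 1 := by
  rw [Finset.card_erase_of_mem zero_mem_codewords, codeSize,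
    Nat.cast_sub (Finset.card_pos.2 ⟨0, zero_mem_codewords⟩), Nat.cast_one]

theorem sum_spectrumPMF (hC : C ≠ ⊥) : ∑ l, spectrumPMF C l = 1 := by
  simp only [spectrumPMF]
  rw [← Finset.sum_div, div_eq_one_iff_eq (codeSize_sub_one_pos hC).ne',
    Finset.sum_congr rfl fun l _ => spectrum_eq C l, Finset.sum_comm, ← card_codewords_erase]
  simp

theorem spectrumPMF_nonneg (hC : C ≠ ⊥) (l : Fin (N + 1)) : 0 ≤ spectrumPMF C l :=
  div_nonneg (Nat.cast_nonneg _) (codeSize_sub_one_pos hC).le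

theorem binomialHalf_pos (l : Fin (N + 1)) : 0 < binomialHalf N l :=
  div_pos (choose_weight_pos l) (by positivity)

theorem sum_binomialHalf : ∑ l, binomialHalf N l = 1 := by
  simp only [binomialHalf]
  rw [← Finset.sum_div, div_eq_one_iff_eq (by positivity)]
  have := Nat.sum_range_choose N
  rw [Finset.sum_range] at this
  exact_mod_cast this

/-- The density of the distance spectrum with respect to the binomial distribution. -/
def spectrumRatio (C : Submodule (ZMod 2) (Fin N → ZMod 2)) (l : Fin (N + 1)) : ℝ :=
  spectrumPMF C l / binomialHalf N l

theorem spectrumRatio_nonneg (hC : C ≠ ⊥) (l : Fin (N + 1)) : 0 ≤ spectrumRatio C l :=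
  div_nonneg (spectrumPMF_nonneg hC l) (binomialHalf_pos l).le

theorem binomialHalf_mul_spectrumRatio (l : Fin (N + 1)) :
    binomialHalf N l * spectrumRatio C l = spectrumPMF C l :=
  mul_div_cancel₀ _ (binomialHalf_pos l).ne'

/-- The `S_l` codewords of weight `l` are each spread evenly over the `N.choose l` words of that
weight, and `S_l / N.choose l` is `(M - 1) 2^(-N)` times the ratio of `P_N` to `Q_N` at `l`. -/
theorem perm_average_eq (hC : C ≠ ⊥) (φ : (Fin N → ZMod 2) → ℝ) :
    (∑ σ : Equiv.Perm (Fin N), ∑ w ∈ (codewords C).erase 0, φ (w ∘ σ)) / N.factorial =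
      ((codeSize C : ℝ) - 1) *
        ∑ u : Fin N → ZMod 2, spectrumRatio C (weight u) / 2 ^ N * φ u := by
  rw [Finset.sum_comm, Finset.sum_div, Finset.sum_congr rfl fun w _ => sum_perm_comp w φ,
    Finset.sum_comm, Finset.mul_sum]
  refine Finset.sum_congr rfl fun u _ => ?_
  have h1 : (∑ w ∈ (codewords C).erase 0,
      if weight u = weight w then φ u / (N.choose (weight u) : ℝ) else 0) =
      spectrum C (weight u) * (φ u / N.choose (weight u)) := by
    rw [spectrum_eq, Finset.sum_mul]
    refine Finset.sum_congr rfl fun w _ => ?_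
    split_ifs <;> simp
  rw [h1, spectrumRatio, spectrumPMF, binomialHalf]
  have := (codeSize_sub_one_pos hC).ne'
  have := (choose_weight_pos (weight u)).ne'
  field_simp

/-! ### The Rényi divergence of the distance spectrum -/

/-- The ratio has mean one under the binomial distribution. This and the next lemma make the
divergences nonnegative and the arguments of their logarithms positive. -/
theorem one_le_iSup_spectrumRatio (hC : C ≠ ⊥) : 1 ≤ ⨆ l, spectrumRatio C l := by
  have hb : BddAbove (Set.range (spectrumRatio C)) := (Set.finite_range _).bddAbove
  calc
    1 = ∑ l, binomialHalf N l * spectrumRatio C l := by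
      simp_rw [binomialHalf_mul_spectrumRatio, sum_spectrumPMF hC]
    _ ≤ ∑ l, binomialHalf N l * ⨆ l, spectrumRatio C l :=
      Finset.sum_le_sum fun l _ =>
        mul_le_mul_of_nonneg_left (le_ciSup hb l) (binomialHalf_pos l).le
    _ = _ := by rw [← Finset.sum_mul, sum_binomialHalf, one_mul]

theorem one_le_sum_spectrumRatio_rpow (hC : C ≠ ⊥) {s : ℝ} (hs : 1 ≤ s) :
    1 ≤ ∑ l, binomialHalf N l * spectrumRatio C l ^ s := by
  have := Real.rpow_arith_mean_le_arith_mean_rpow Finset.univ (binomialHalf N) (spectrumRatio C)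
    (fun l _ => (binomialHalf_pos l).le) sum_binomialHalf (fun l _ => spectrumRatio_nonneg hC l) hs
  simp_rw [binomialHalf_mul_spectrumRatio, sum_spectrumPMF hC, Real.one_rpow] at this
  exact this

theorem renyiDiv_conjOrder_one :
    renyiDiv (conjOrder 1) (spectrumPMF C) (binomialHalf N) =
      Real.log (⨆ l, spectrumRatio C l) := by
  simp [renyiDiv, conjOrder, spectrumRatio]

theorem renyiDiv_conjOrder (hC : C ≠ ⊥) {r : ℝ} (hr : 1 < r) :
    renyiDiv (conjOrder r) (spectrumPMF C) (binomialHalf N) =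
      (r - 1) * Real.log (∑ l, binomialHalf N l * spectrumRatio C l ^ (r / (r - 1))) := by
  have hr1 : 0 < r - 1 := by linarith
  have hs : 1 < r / (r - 1) := by rw [lt_div_iff₀ hr1]; linarith
  have h1 : (ENNReal.ofReal (r / (r - 1))).toReal = r / (r - 1) :=
    ENNReal.toReal_ofReal (by positivity)
  rw [conjOrder, if_neg hr.ne', renyiDiv, if_neg ENNReal.ofReal_ne_top,
    if_neg (by simpa using by positivity), if_neg (by rw [ENNReal.ofReal_eq_one]; exact hs.ne'), h1]
  congr 1
  · field_simp
    ring
  · congr 1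
    refine Finset.sum_congr rfl fun l _ => ?_
    have hQ := binomialHalf_pos l
    rw [spectrumRatio, Real.div_rpow (spectrumPMF_nonneg hC l) hQ.le, Real.rpow_sub hQ,
      Real.rpow_one]
    ring

theorem renyiDiv_conjOrder_nonneg (hC : C ≠ ⊥) {r : ℝ} (hr : 1 ≤ r) :
    0 ≤ renyiDiv (conjOrder r) (spectrumPMF C) (binomialHalf N) := by
  rcases hr.eq_or_lt with rfl | hr
  · rw [renyiDiv_conjOrder_one]
    exact Real.log_nonneg (one_le_iSup_spectrumRatio hC)
  · rw [renyiDiv_conjOrder hC hr]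
    have hr1 : 0 < r - 1 := by linarith
    exact mul_nonneg hr1.le (Real.log_nonneg
      (one_le_sum_spectrumRatio_rpow hC (by rw [le_div_iff₀ hr1]; linarith)))

/-- Hölder's inequality for the uniform distribution on words, whose weights have the binomial law.
Since `1/s = (r-1)/r`, the `L^s` norm of the ratio is exactly `exp(D_s/r)`; for `r = 1` it becomes
the supremum. -/
theorem sum_spectrumRatio_mul_le (hC : C ≠ ⊥) {r : ℝ} (hr : 1 ≤ r)
    {φ : (Fin N → ZMod 2) → ℝ} (hφ : ∀ u, 0 ≤ φ u) :
    ∑ u : Fin N → ZMod 2, spectrumRatio C (weight u) / 2 ^ N * φ u ≤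
      Real.exp (renyiDiv (conjOrder r) (spectrumPMF C) (binomialHalf N) / r) *
        ((∑ u, φ u ^ r) / 2 ^ N) ^ (1 / r) := by
  rcases hr.eq_or_lt with rfl | hr
  · have hb : BddAbove (Set.range (spectrumRatio C)) := (Set.finite_range _).bddAbove
    rw [renyiDiv_conjOrder_one, div_one,
      Real.exp_log (zero_lt_one.trans_le (one_le_iSup_spectrumRatio hC))]
    simp only [Real.rpow_one, div_one]
    rw [Finset.sum_div, Finset.mul_sum]
    refine Finset.sum_le_sum fun u _ => ?_
    rw [div_mul_eq_mul_div, mul_div_assoc]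
    exact mul_le_mul_of_nonneg_right (le_ciSup hb _) (div_nonneg (hφ u) (by positivity))
  · have hr1 : 0 < r - 1 := by linarith
    set s := r / (r - 1) with hs
    have hs0 : 0 < s := by positivity
    have hconj : s.HolderConjugate r := (Real.HolderConjugate.conjExponent hr).symm
    have hadd : 1 / s + 1 / r = 1 := by simpa using hconj.inv_add_inv_eq_one
    have h2 : (0 : ℝ) < 2 ^ N := by positivity
    have hZ := one_le_sum_spectrumRatio_rpow hC (s := s) (by rw [le_div_iff₀ hr1]; linarith)
    have hexp : Real.exp (renyiDiv (conjOrder r) (spectrumPMF C) (binomialHalf N) / r) =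
        (∑ l, binomialHalf N l * spectrumRatio C l ^ s) ^ (1 / s) := by
      rw [renyiDiv_conjOrder hC hr, Real.rpow_def_of_pos (by linarith)]
      congr 1
      rw [hs]
      field_simp
    -- The uniform weight `2^(-N)` is split as `(2^N)^(-1/s) (2^N)^(-1/r)` between the two factors,
    -- so that the unweighted Hölder inequality applies.
    have hZ' : ∑ l, binomialHalf N l * spectrumRatio C l ^ s =
        ∑ u : Fin N → ZMod 2, (spectrumRatio C (weight u) / (2 ^ N) ^ (1 / s)) ^ s := by
      rw [sum_weight (g := fun l => (spectrumRatio C l / (2 ^ N) ^ (1 / s)) ^ s)]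
      refine Finset.sum_congr rfl fun l _ => ?_
      rw [Real.div_rpow (spectrumRatio_nonneg hC l) (by positivity), ← Real.rpow_mul h2.le,
        one_div_mul_cancel hs0.ne', Real.rpow_one, binomialHalf]
      ring
    have hφ' : (∑ u, φ u ^ r) / 2 ^ N = ∑ u, (φ u / (2 ^ N) ^ (1 / r)) ^ r := by
      rw [Finset.sum_div]
      refine Finset.sum_congr rfl fun u _ => ?_
      rw [Real.div_rpow (hφ u) (by positivity), ← Real.rpow_mul h2.le,
        one_div_mul_cancel (by positivity), Real.rpow_one]
    rw [hexp, hZ', hφ']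
    refine le_of_eq_of_le (Finset.sum_congr rfl fun u _ => ?_)
      (Real.inner_le_Lp_mul_Lq_of_nonneg Finset.univ hconj
        (fun u _ => div_nonneg (spectrumRatio_nonneg hC _) (by positivity))
        (fun u _ => div_nonneg (hφ u) (by positivity)))
    rw [div_mul_div_comm, ← Real.rpow_add h2, hadd, Real.rpow_one]
    ring

/-- The average over all permutations of the coordinates of a concave functional of the code. -/
theorem perm_average_rpow_le (hC : C ≠ ⊥) {r ρ : ℝ} (hr : 1 ≤ r) (hρ0 : 0 ≤ ρ) (hρ1 : ρ ≤ 1)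
    {φ : (Fin N → ZMod 2) → ℝ} (hφ : ∀ u, 0 ≤ φ u) :
    (∑ σ : Equiv.Perm (Fin N), (∑ w ∈ (codewords C).erase 0, φ (w ∘ σ)) ^ ρ) / N.factorial ≤
      (((codeSize C : ℝ) - 1) *
        (Real.exp (renyiDiv (conjOrder r) (spectrumPMF C) (binomialHalf N) / r) *
          ((∑ u, φ u ^ r) / 2 ^ N) ^ (1 / r))) ^ ρ := by
  have hf : (0 : ℝ) < N.factorial := by exact_mod_cast N.factorial_pos
  -- Jensen's inequality with equal weights `1/N!`; this is where `ρ ≤ 1`, that is `ρ' ≤ 1/r`, is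
  -- needed.
  have hJ := (Real.concaveOn_rpow hρ0 hρ1).le_map_sum (t := Finset.univ)
    (w := fun _ : Equiv.Perm (Fin N) => (N.factorial : ℝ)⁻¹)
    (p := fun σ => ∑ w ∈ (codewords C).erase 0, φ (w ∘ σ)) (fun _ _ => by positivity)
    (by simp [Fintype.card_perm, hf.ne']) (fun σ _ => Finset.sum_nonneg fun w _ => hφ _)
  simp only [smul_eq_mul, ← Finset.mul_sum] at hJ
  rw [div_eq_inv_mul]
  refine hJ.trans (Real.rpow_le_rpow ?_ ?_ hρ0)
  · exact mul_nonneg (by positivity) (Finset.sum_nonneg fun σ _ =>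
      Finset.sum_nonneg fun w _ => hφ _)
  · rw [← div_eq_inv_mul, perm_average_eq hC]
    exact mul_le_mul_of_nonneg_left (sum_spectrumRatio_mul_le hC hr hφ)
      (codeSize_sub_one_pos hC).le

end

section

variable {Y : Type*} [MeasurableSpace Y] {N : ℕ}

/-! ### Normal form of a symmetric channel -/

/-- The involution `τ` preserves the reference measure and exchanges the two transition
densities pointwise. -/
structure BinaryChannel.IsSymmetricUnder (ch : BinaryChannel Y) (τ : Y → Y) : Prop where
  involutive : Function.Involutive τ
  measurePreserving : MeasurePreserving τ ch.ref ch.ref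
  dens_add : ∀ x v y, ch.dens (x + v) (τ^[v.val] y) = ch.dens x y

/-- The channel `ch'` describes the same output laws as `ch`, its reference measure having the
density `s` with respect to that of `ch`. -/
structure BinaryChannel.IsRescaling (ch' ch : BinaryChannel Y) (s : Y → ℝ≥0) : Prop where
  measurable : Measurable s
  ref_eq : ch'.ref = ch.ref.withDensity fun y => (s y : ℝ≥0∞)
  dens_eq : ∀ᵐ y ∂ch.ref, ∀ x, ch.dens x y = s y * ch'.dens x y

namespace BinaryChannel

theorem IsRescaling.law_eq {ch' ch : BinaryChannel Y} {s : Y → ℝ≥0} (h : ch'.IsRescaling ch s)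
    (x : ZMod 2) : ch'.law x = ch.law x := by
  rw [law, law, h.ref_eq, ← withDensity_mul _ h.measurable.coe_nnreal_ennreal
    (ch'.measurable_dens x).coe_nnreal_ennreal]
  refine withDensity_congr_ae ?_
  filter_upwards [h.dens_eq] with y hy
  simp [hy x]

theorem IsRescaling.blockLaw_eq {ch' ch : BinaryChannel Y} {s : Y → ℝ≥0}
    (h : ch'.IsRescaling ch s) (c : Fin N → ZMod 2) : ch'.blockLaw c = ch.blockLaw c := by
  simp [blockLaw, h.law_eq]

theorem IsRescaling.ae_law {ch' ch : BinaryChannel Y} {s : Y → ℝ≥0}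
    (h : ch'.IsRescaling ch s) (x : ZMod 2) :
    ∀ᵐ y ∂ch.law x, 0 < s y ∧ ∀ x', ch.dens x' y = s y * ch'.dens x' y := by
  rw [law, ae_withDensity_iff (ch.measurable_dens x).coe_nnreal_ennreal]
  filter_upwards [h.dens_eq] with y hy hx
  refine ⟨pos_of_ne_zero fun h0 => hx ?_, hy⟩
  simp [hy x, h0]

/-- Almost surely, the likelihoods in two descriptions of a channel are proportional. -/
theorem IsRescaling.ae_likelihood {ch' ch : BinaryChannel Y} {s : Y → ℝ≥0}
    (h : ch'.IsRescaling ch s) (c : Fin N → ZMod 2) :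
    ∀ᵐ y ∂ch.blockLaw c, ∃ K : ℝ≥0, 0 < K ∧
      ∀ c', ch.likelihood y c' = K * ch'.likelihood y c' := by
  have hi : ∀ᵐ y ∂ch.blockLaw c, ∀ i, 0 < s (y i) ∧
      ∀ x', ch.dens x' (y i) = s (y i) * ch'.dens x' (y i) :=
    ae_all_iff.2 fun i => (Measure.tendsto_eval_ae_ae (μ := fun i => ch.law (c i))).eventually
      (h.ae_law (c i))
  filter_upwards [hi] with y hy
  refine ⟨∏ i, s (y i), Finset.prod_pos fun i _ => (hy i).1, fun c' => ?_⟩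
  simp only [likelihood, fun i x' => (hy i).2 x', Finset.prod_mul_distrib]

theorem IsRescaling.ae_isMostLikely_iff {ch' ch : BinaryChannel Y} {s : Y → ℝ≥0}
    (h : ch'.IsRescaling ch s) (C : Submodule (ZMod 2) (Fin N → ZMod 2)) (c : Fin N → ZMod 2) :
    ∀ᵐ y ∂ch.blockLaw c, ∀ c', IsMostLikely ch C y c' ↔ IsMostLikely ch' C y c' := by
  filter_upwards [h.ae_likelihood c] with y ⟨K, hK, hy⟩ c'
  simp only [IsMostLikely, hy, mul_le_mul_iff_right₀ hK]

/-- The integrand is homogeneous of degree one in the pair of densities, so the factor `s` passes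
into the reference measure. -/
theorem IsRescaling.gallagerE0_eq {ch' ch : BinaryChannel Y} {s : Y → ℝ≥0}
    (h : ch'.IsRescaling ch s) {ρ : ℝ} (hρ : 0 ≤ ρ) {q : ZMod 2 → ℝ} (hq : ∀ x, 0 ≤ q x) :
    ch'.gallagerE0 ρ q = ch.gallagerE0 ρ q := by
  rw [gallagerE0, gallagerE0, h.ref_eq, integral_withDensity_eq_integral_smul h.measurable]
  congr 2
  refine integral_congr_ae ?_
  filter_upwards [h.dens_eq] with y hy
  have h1 : 0 < 1 + ρ := by linarith
  simp only [hy, NNReal.coe_mul, NNReal.smul_def, smul_eq_mul]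
  simp_rw [Real.mul_rpow (s y).coe_nonneg (NNReal.coe_nonneg _), mul_left_comm (q _)]
  rw [← Finset.mul_sum, Real.mul_rpow (by positivity) (Finset.sum_nonneg fun x _ =>
    mul_nonneg (hq x) (by positivity)), ← Real.rpow_mul (s y).coe_nonneg,
    one_div_mul_cancel h1.ne', Real.rpow_one]

/-- An output-symmetric channel can be described by densities which are exchanged pointwise by a
measure-preserving involution. -/
theorem exists_isRescaling (ch : BinaryChannel Y) (hch : ch.IsOutputSymmetric) :
    ∃ (ch' : BinaryChannel Y) (s : Y → ℝ≥0) (τ : Y → Y),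
      ch'.IsRescaling ch s ∧ ch'.IsSymmetricUnder τ := by
  obtain ⟨τ, hτm, hτ, hlaw⟩ := hch
  have hττ : τ ∘ τ = id := hτ.comp_self
  have hlaw' : ch.law 0 = (ch.law 1).map τ := by
    rw [hlaw, Measure.map_map hτm hτm, hττ, Measure.map_id]
  set s : Y → ℝ≥0 := fun y => ch.dens 0 y + ch.dens 1 y with hs
  have hsm : Measurable s := (ch.measurable_dens 0).add (ch.measurable_dens 1)
  -- This is the sum of the two output laws. Unlike the original reference measure, it is
  -- necessarily invariant under `τ`, which exchanges them.
  set μ : Measure Y := ch.ref.withDensity fun y => (s y : ℝ≥0∞) with hμ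
  have hμ' : μ = ch.law 0 + ch.law 1 := by
    rw [hμ, law, law, ← withDensity_add_left (ch.measurable_dens 0).coe_nnreal_ennreal]
    rfl
  have hfin : IsFiniteMeasure μ := by rw [hμ']; infer_instance
  have hmp : MeasurePreserving τ μ μ := by
    refine ⟨hτm, ?_⟩
    rw [hμ', Measure.map_add _ _ hτm, ← hlaw, ← hlaw', add_comm]
  -- Where `s` vanishes both densities vanish, so the default value of division by zero is harmless.
  set h : ZMod 2 → Y → ℝ≥0 := fun x y => ch.dens x y / s y with hh
  have hhm (x : ZMod 2) : Measurable (h x) := (ch.measurable_dens x).div hsm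
  have hle (x : ZMod 2) (y : Y) : ch.dens x y ≤ s y := by
    have : x = 0 ∨ x = 1 := by revert x; decide
    rcases this with rfl | rfl <;> simp [hs]
  have hdens (x : ZMod 2) (y : Y) : ch.dens x y = s y * h x y := by
    rcases eq_or_ne (s y) 0 with h0 | h0
    · have := hle x y
      rw [h0] at this ⊢
      simpa using this
    · exact (mul_div_cancel₀ _ h0).symm
  have hlawμ (x : ZMod 2) : ch.law x = μ.withDensity fun y => (h x y : ℝ≥0∞) := by
    rw [hμ, ← withDensity_mul _ hsm.coe_nnreal_ennreal (hhm x).coe_nnreal_ennreal, law]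
    congr 1
    funext y
    simp [hdens x y]
  have hhτ (x : ZMod 2) : Measurable fun y => (h x (τ y) : ℝ≥0∞) :=
    ((hhm x).comp hτm).coe_nnreal_ennreal
  have hxx (x : ZMod 2) : x + 1 + 1 = x := by revert x; decide
  have hmap (x : ZMod 2) : (ch.law x).map τ = μ.withDensity fun y => (h x (τ y) : ℝ≥0∞) := by
    ext A hA
    rw [Measure.map_apply hτm hA, hlawμ, withDensity_apply _ (hτm hA), withDensity_apply _ hA,
      ← hmp.setLIntegral_comp_preimage hA (hhτ x)]
    simp only [hτ _]
  have hae (x : ZMod 2) : ∀ᵐ y ∂μ, h x (τ y) = h (x + 1) y := by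
    have h1 : (ch.law x).map τ = ch.law (x + 1) := by
      have : x = 0 ∨ x = 1 := by revert x; decide
      rcases this with rfl | rfl
      · simp [hlaw]
      · rw [← hlaw']; rfl
    rw [hmap, hlawμ, withDensity_eq_iff_of_sigmaFinite
      (hhτ x).aemeasurable
      (hhm _).coe_nnreal_ennreal.aemeasurable] at h1
    filter_upwards [h1] with y hy
    exact_mod_cast hy
  -- The exchange identity for `h` holds only almost everywhere. Averaging `h` with its reflection
  -- makes it hold at every point and changes `h` only on a null set.
  set g : ZMod 2 → Y → ℝ≥0 := fun x y => (h x y + h (x + 1) (τ y)) / 2 with hg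
  have hgm (x : ZMod 2) : Measurable (g x) := ((hhm x).add ((hhm _).comp hτm)).div_const 2
  have hgh (x : ZMod 2) : ∀ᵐ y ∂μ, g x y = h x y := by
    filter_upwards [hae (x + 1)] with y hy
    rw [hxx] at hy
    simp only [hg, hy]
    rw [← two_mul, mul_div_cancel_left₀ _ two_ne_zero]
  have hgτ (x : ZMod 2) (y : Y) : g (x + 1) (τ y) = g x y := by
    simp only [hg, hτ y, hxx, add_comm]
  refine ⟨⟨μ, inferInstance, g, hgm, fun x => ?_⟩, s, τ, ⟨hsm, rfl, ?_⟩, ⟨hτ, hmp, ?_⟩⟩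
  · have h1 : ∫⁻ y, (g x y : ℝ≥0∞) ∂μ = ∫⁻ y, (h x y : ℝ≥0∞) ∂μ := by
      refine lintegral_congr_ae ?_
      filter_upwards [hgh x] with y hy
      rw [hy]
    have h2 : ch.law x Set.univ = 1 := measure_univ
    rw [hlawμ, withDensity_apply _ MeasurableSet.univ, Measure.restrict_univ] at h2
    rw [h1, h2]
  · have h1 : ∀ᵐ y ∂μ, ∀ x, g x y = h x y := ae_all_iff.2 hgh
    rw [hμ, ae_withDensity_iff hsm.coe_nnreal_ennreal] at h1
    filter_upwards [h1] with y hy x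
    rw [hdens x y]
    rcases eq_or_ne (s y) 0 with h0 | h0
    · rw [h0, zero_mul, zero_mul]
    · rw [← hy (by simpa using h0) x]
  · intro x v y
    have : v = 0 ∨ v = 1 := by revert v; decide
    rcases this with rfl | rfl
    · simp
    · exact hgτ x y

/-! ### Translations and permutations of the output block -/

/-- The map `y ↦ (τ^{v_i} y_i)` of output blocks. -/
def translate (τ : Y → Y) (v : Fin N → ZMod 2) (y : Fin N → Y) : Fin N → Y :=
  fun i => τ^[(v i).val] (y i)

theorem IsSymmetricUnder.measurePreserving_translate {ch : BinaryChannel Y} {τ : Y → Y}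
    (h : ch.IsSymmetricUnder τ) (v : Fin N → ZMod 2) :
    MeasurePreserving (translate τ v) (ch.blockRef N) (ch.blockRef N) :=
  measurePreserving_pi _ _ fun _ => h.measurePreserving.iterate _

theorem IsSymmetricUnder.likelihood_translate {ch : BinaryChannel Y} {τ : Y → Y}
    (h : ch.IsSymmetricUnder τ) (v : Fin N → ZMod 2) (y : Fin N → Y) (c : Fin N → ZMod 2) :
    ch.likelihood (translate τ v y) (c + v) = ch.likelihood y c :=
  Finset.prod_congr rfl fun i _ => h.dens_add (c i) (v i) (y i)

theorem IsSymmetricUnder.measurePreserving_blockLaw {ch : BinaryChannel Y} {τ : Y → Y}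
    (h : ch.IsSymmetricUnder τ) (v : Fin N → ZMod 2) :
    MeasurePreserving (translate τ v) (ch.blockLaw 0) (ch.blockLaw v) := by
  have hm := h.measurePreserving_translate v
  refine ⟨hm.measurable, ?_⟩
  ext A hA
  rw [Measure.map_apply hm.measurable hA, blockLaw_eq_withDensity, blockLaw_eq_withDensity,
    withDensity_apply _ (hm.measurable hA), withDensity_apply _ hA,
    ← hm.setLIntegral_comp_preimage hA (ch.measurable_likelihood v).coe_nnreal_ennreal]
  refine lintegral_congr fun y => ?_
  rw [← h.likelihood_translate v y 0, zero_add]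

theorem IsSymmetricUnder.isMostLikely_translate {ch : BinaryChannel Y} {τ : Y → Y}
    (h : ch.IsSymmetricUnder τ) {C : Submodule (ZMod 2) (Fin N → ZMod 2)} {v : Fin N → ZMod 2}
    (hv : v ∈ C) (y : Fin N → Y) (c : Fin N → ZMod 2) :
    IsMostLikely ch C (translate τ v y) (c + v) ↔ IsMostLikely ch C y c := by
  rw [IsMostLikely, IsMostLikely, h.likelihood_translate, C.add_mem_iff_left hv]
  refine and_congr_right fun _ => ⟨fun H c' hc' => ?_, fun H c' hc' => ?_⟩
  · rw [← h.likelihood_translate v]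
    exact H _ (C.add_mem hc' hv)
  · rw [← sub_add_cancel c' v, h.likelihood_translate]
    exact H _ (C.sub_mem hc' hv)

theorem measurePreserving_comp_perm (ch : BinaryChannel Y) (σ : Equiv.Perm (Fin N)) :
    MeasurePreserving (fun y : Fin N → Y => y ∘ σ) (ch.blockRef N) (ch.blockRef N) := by
  have := measurePreserving_arrowCongr' (fun _ : Fin N => ch.ref) (fun _ : Fin N => ch.ref)
    σ.symm (MeasurableEquiv.refl Y) fun _ => MeasurePreserving.id _
  exact this

theorem likelihood_comp_perm (ch : BinaryChannel Y) (σ : Equiv.Perm (Fin N)) (y : Fin N → Y)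
    (c : Fin N → ZMod 2) : ch.likelihood (y ∘ σ) (c ∘ σ) = ch.likelihood y c :=
  Equiv.prod_comp σ fun i => ch.dens (c i) (y i)

end BinaryChannel

end

section

variable {Y : Type*} [MeasurableSpace Y] {N : ℕ}

/-! ### Gallager's function -/

theorem sum_zmod_two {M : Type*} [AddCommMonoid M] (f : ZMod 2 → M) : ∑ x, f x = f 0 + f 1 :=
  Fin.sum_univ_two f

theorem uniformInput_mem_stdSimplex : uniformInput ∈ stdSimplex ℝ (ZMod 2) :=
  ⟨fun x => by norm_num [uniformInput], by rw [sum_zmod_two]; norm_num [uniformInput]⟩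

namespace BinaryChannel

/-- The integrand of Gallager's function. -/
def gallagerIntegrand (ch : BinaryChannel Y) (ρ : ℝ) (q : ZMod 2 → ℝ) (y : Y) : ℝ :=
  (∑ x, q x * (ch.dens x y : ℝ) ^ (1 / (1 + ρ))) ^ (1 + ρ)

theorem gallagerE0_def (ch : BinaryChannel Y) (ρ : ℝ) (q : ZMod 2 → ℝ) :
    ch.gallagerE0 ρ q = -Real.log (∫ y, ch.gallagerIntegrand ρ q y ∂ch.ref) := rfl

variable (ch : BinaryChannel Y) {ρ : ℝ} {q : ZMod 2 → ℝ}

@[fun_prop]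
theorem measurable_gallagerIntegrand (ρ : ℝ) (q : ZMod 2 → ℝ) :
    Measurable (ch.gallagerIntegrand ρ q) := by
  unfold gallagerIntegrand
  have h (x : ZMod 2) : Measurable (ch.dens x) := ch.measurable_dens x
  fun_prop

theorem integrable_dens (x : ZMod 2) : Integrable (fun y => (ch.dens x y : ℝ)) ch.ref := by
  refine ⟨(ch.measurable_dens x).coe_nnreal_real.aestronglyMeasurable, ?_⟩
  rw [hasFiniteIntegral_iff_ofNNReal, ch.lintegral_dens x]
  exact ENNReal.one_lt_top

theorem integral_dens (x : ZMod 2) : ∫ y, (ch.dens x y : ℝ) ∂ch.ref = 1 := by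
  rw [integral_eq_lintegral_of_nonneg_ae (Filter.Eventually.of_forall fun y => NNReal.coe_nonneg _)
    (ch.measurable_dens x).coe_nnreal_real.aestronglyMeasurable]
  simp [ch.lintegral_dens x]

theorem gallagerIntegrand_nonneg (hq : ∀ x, 0 ≤ q x) (y : Y) :
    0 ≤ ch.gallagerIntegrand ρ q y :=
  Real.rpow_nonneg (Finset.sum_nonneg fun x _ => mul_nonneg (hq x) (by positivity)) _

theorem gallagerIntegrand_le (hρ : 0 ≤ ρ) (hq : q ∈ stdSimplex ℝ (ZMod 2)) (y : Y) :
    ch.gallagerIntegrand ρ q y ≤ ∑ x, q x * ch.dens x y := by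
  have h1 : 0 < 1 + ρ := by linarith
  refine (Real.rpow_arith_mean_le_arith_mean_rpow Finset.univ q
    (fun x => (ch.dens x y : ℝ) ^ (1 / (1 + ρ))) (fun x _ => hq.1 x) hq.2
    (fun x _ => by positivity) (by linarith : 1 ≤ 1 + ρ)).trans_eq ?_
  refine Finset.sum_congr rfl fun x _ => ?_
  rw [← Real.rpow_mul (NNReal.coe_nonneg _), one_div_mul_cancel h1.ne', Real.rpow_one]

theorem integrable_gallagerIntegrand (hρ : 0 ≤ ρ) (hq : q ∈ stdSimplex ℝ (ZMod 2)) :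
    Integrable (ch.gallagerIntegrand ρ q) ch.ref := by
  refine Integrable.mono' (g := fun y => ∑ x, q x * (ch.dens x y : ℝ))
    (integrable_finsetSum _ fun x _ => (ch.integrable_dens x).const_mul _)
    (ch.measurable_gallagerIntegrand ρ q).aestronglyMeasurable
    (Filter.Eventually.of_forall fun y => ?_)
  rw [Real.norm_of_nonneg (ch.gallagerIntegrand_nonneg hq.1 y)]
  exact ch.gallagerIntegrand_le hρ hq y

/-- Superadditivity of `x ↦ x^(1+ρ)` on nonnegative reals bounds the integrand below by a multiple
of the sum of the densities. The integral is thus positive, so its logarithm is meaningful, and `E₀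
≤ ρ log 2`. -/
theorem le_integral_gallagerIntegrand (hρ : 0 ≤ ρ) :
    (2 : ℝ) ^ (-ρ) ≤ ∫ y, ch.gallagerIntegrand ρ uniformInput y ∂ch.ref := by
  have h1 : 0 < 1 + ρ := by linarith
  have hu (x : ZMod 2) : uniformInput x = 1 / 2 := rfl
  have hle (y : Y) : (2 : ℝ) ^ (-(1 + ρ)) * (ch.dens 0 y + ch.dens 1 y) ≤
      ch.gallagerIntegrand ρ uniformInput y := by
    have := Real.add_rpow_le_rpow_add (a := (ch.dens 0 y : ℝ) ^ (1 / (1 + ρ)))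
      (b := (ch.dens 1 y : ℝ) ^ (1 / (1 + ρ))) (by positivity) (by positivity)
      (by linarith : 1 ≤ 1 + ρ)
    simp only [← Real.rpow_mul (NNReal.coe_nonneg _), one_div_mul_cancel h1.ne',
      Real.rpow_one] at this
    rw [gallagerIntegrand, sum_zmod_two, hu, hu, ← mul_add,
      Real.mul_rpow (by norm_num) (by positivity), one_div, Real.inv_rpow (by norm_num),
      ← Real.rpow_neg (by norm_num)]
    exact mul_le_mul_of_nonneg_left this (by positivity)
  have hint := (ch.integrable_dens 0).add (ch.integrable_dens 1)
  calc
    (2 : ℝ) ^ (-ρ) = ∫ y, (2 : ℝ) ^ (-(1 + ρ)) * (ch.dens 0 y + ch.dens 1 y : ℝ) ∂ch.ref := by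
      rw [integral_const_mul, integral_add (ch.integrable_dens 0) (ch.integrable_dens 1),
        ch.integral_dens, ch.integral_dens, neg_add, Real.rpow_add (by norm_num),
        Real.rpow_neg_one]
      ring
    _ ≤ _ := integral_mono (hint.const_mul _)
      (ch.integrable_gallagerIntegrand hρ uniformInput_mem_stdSimplex) hle

theorem integral_gallagerIntegrand_pos (hρ : 0 ≤ ρ) :
    0 < ∫ y, ch.gallagerIntegrand ρ uniformInput y ∂ch.ref :=
  (by positivity : (0 : ℝ) < 2 ^ (-ρ)).trans_le (ch.le_integral_gallagerIntegrand hρ)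

theorem exp_neg_gallagerE0 (hρ : 0 ≤ ρ) :
    Real.exp (-ch.gallagerE0 ρ uniformInput) =
      ∫ y, ch.gallagerIntegrand ρ uniformInput y ∂ch.ref := by
  rw [gallagerE0_def, neg_neg, Real.exp_log (ch.integral_gallagerIntegrand_pos hρ)]

theorem gallagerE0_le (hρ : 0 ≤ ρ) : ch.gallagerE0 ρ uniformInput ≤ ρ * Real.log 2 := by
  have := Real.log_le_log (by positivity) (ch.le_integral_gallagerIntegrand hρ)
  rw [Real.log_rpow (by norm_num)] at this
  rw [gallagerE0_def]
  linarith

/-- Dominated convergence, with the averaged density as a majorant independent of `ρ`. Continuity is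
what makes the maxima over `ρ'` attained. -/
theorem continuousOn_gallagerE0 :
    ContinuousOn (fun ρ => ch.gallagerE0 ρ uniformInput) (Set.Ici 0) := by
  have hpos (ρ : ℝ) (hρ : ρ ∈ Set.Ici (0 : ℝ)) : 0 < 1 + ρ := by
    have : 0 ≤ ρ := hρ
    linarith
  refine (ContinuousOn.log ?_ fun ρ hρ => (ch.integral_gallagerIntegrand_pos hρ).ne').neg
  refine continuousOn_of_dominated (bound := fun y => ∑ x, uniformInput x * (ch.dens x y : ℝ))
    (fun ρ _ => (ch.measurable_gallagerIntegrand ρ _).aestronglyMeasurable)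
    (fun ρ hρ => Filter.Eventually.of_forall fun y => ?_)
    (integrable_finsetSum _ fun x _ => (ch.integrable_dens x).const_mul _)
    (Filter.Eventually.of_forall fun y => ?_)
  · rw [Real.norm_of_nonneg (ch.gallagerIntegrand_nonneg uniformInput_mem_stdSimplex.1 y)]
    exact ch.gallagerIntegrand_le hρ uniformInput_mem_stdSimplex y
  · have h1 : ContinuousOn (fun ρ : ℝ => 1 + ρ) (Set.Ici 0) := by fun_prop
    have h2 : ContinuousOn (fun ρ : ℝ => 1 / (1 + ρ)) (Set.Ici 0) :=
      continuousOn_const.div h1 fun ρ hρ => (hpos ρ hρ).ne'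
    unfold gallagerIntegrand
    refine ContinuousOn.rpow (continuousOn_finsetSum _ fun x _ => continuousOn_const.mul ?_) h1
      fun ρ hρ => Or.inr (hpos ρ hρ)
    exact continuousOn_const.rpow h2 fun ρ hρ => Or.inr (one_div_pos.2 (hpos ρ hρ))

/-- Swapping the two entries of `q` leaves the integral unchanged, by the substitution `τ`. The
integrand is convex in `q`, and the uniform input is the midpoint of `q` and its swap. -/
theorem IsSymmetricUnder.gallagerE0_le_uniformInput {ch : BinaryChannel Y} {τ : Y → Y}
    (h : ch.IsSymmetricUnder τ) (hρ : 0 ≤ ρ) (hq : q ∈ stdSimplex ℝ (ZMod 2)) :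
    ch.gallagerE0 ρ q ≤ ch.gallagerE0 ρ uniformInput := by
  have hsum : q 0 + q 1 = 1 := by rw [← sum_zmod_two]; exact hq.2
  set q' : ZMod 2 → ℝ := fun x => q (x + 1) with hq'
  have h11 : (1 : ZMod 2) + 1 = 0 := rfl
  have hq'0 : q' 0 = q 1 := by simp [hq']
  have hq'1 : q' 1 = q 0 := by simp [hq', h11]
  have hmem : q' ∈ stdSimplex ℝ (ZMod 2) :=
    ⟨fun x => hq.1 _, by rw [sum_zmod_two, hq'0, hq'1, add_comm]; exact hsum⟩
  have hτ0 (y : Y) : ch.dens 0 (τ y) = ch.dens 1 y := h.dens_add 1 1 y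
  have hτ1 (y : Y) : ch.dens 1 (τ y) = ch.dens 0 y := h.dens_add 0 1 y
  have hswap : ∫ y, ch.gallagerIntegrand ρ q' y ∂ch.ref =
      ∫ y, ch.gallagerIntegrand ρ q y ∂ch.ref := by
    let e : Y ≃ᵐ Y := ⟨h.involutive.toPerm, h.measurePreserving.measurable,
      h.measurePreserving.measurable⟩
    rw [← (show MeasurePreserving e ch.ref ch.ref from h.measurePreserving).integral_comp'
      (ch.gallagerIntegrand ρ q)]
    refine integral_congr_ae (Filter.Eventually.of_forall fun y => ?_)
    change _ = ch.gallagerIntegrand ρ q (τ y)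
    simp only [gallagerIntegrand, sum_zmod_two, hq'0, hq'1, hτ0, hτ1]
    rw [add_comm]
  have hconv (y : Y) : ch.gallagerIntegrand ρ uniformInput y ≤
      1 / 2 * ch.gallagerIntegrand ρ q y + 1 / 2 * ch.gallagerIntegrand ρ q' y := by
    have hnn (p : ZMod 2 → ℝ) (hp : ∀ x, 0 ≤ p x) :
        ∑ x, p x * (ch.dens x y : ℝ) ^ (1 / (1 + ρ)) ∈ Set.Ici (0 : ℝ) :=
      Finset.sum_nonneg fun x _ => mul_nonneg (hp x) (by positivity)
    have hc := (convexOn_rpow (by linarith : 1 ≤ 1 + ρ)).2 (hnn q hq.1) (hnn q' hmem.1)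
      (by norm_num : (0 : ℝ) ≤ 1 / 2) (by norm_num : (0 : ℝ) ≤ 1 / 2) (by norm_num)
    simp only [smul_eq_mul] at hc
    refine le_of_eq_of_le ?_ hc
    rw [gallagerIntegrand]
    congr 1
    simp only [sum_zmod_two, hq'0, hq'1, uniformInput]
    linear_combination (-1 / 2 * ((ch.dens 0 y : ℝ) ^ (1 / (1 + ρ)) +
      (ch.dens 1 y : ℝ) ^ (1 / (1 + ρ)))) * hsum
  have hle : ∫ y, ch.gallagerIntegrand ρ uniformInput y ∂ch.ref ≤
      ∫ y, ch.gallagerIntegrand ρ q y ∂ch.ref := by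
    have h1 := (ch.integrable_gallagerIntegrand hρ hq).const_mul (1 / 2)
    have h2 := (ch.integrable_gallagerIntegrand hρ hmem).const_mul (1 / 2)
    refine (integral_mono (ch.integrable_gallagerIntegrand hρ uniformInput_mem_stdSimplex)
      (h1.add h2) hconv).trans_eq ?_
    rw [integral_add' h1 h2, integral_const_mul, integral_const_mul, hswap]
    ring
  rw [gallagerE0_def, gallagerE0_def, neg_le_neg_iff]
  exact Real.log_le_log (ch.integral_gallagerIntegrand_pos hρ) hle

end BinaryChannel

end

section

variable {Y : Type*} [MeasurableSpace Y] {N : ℕ}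

/-! ### The error bound -/

/-- The integrand of Gallager's bound on the error probability when the word `v` is sent and the
competing words are `w ∘ σ + v` for the non-zero codewords `w`. -/
def errorIntegrand (ch : BinaryChannel Y) (C : Submodule (ZMod 2) (Fin N → ZMod 2))
    (t l ρ : ℝ) (v : Fin N → ZMod 2) (σ : Equiv.Perm (Fin N)) (y : Fin N → Y) : ℝ :=
  (ch.likelihood y v : ℝ) ^ t *
    (∑ w ∈ (codewords C).erase 0, (ch.likelihood y (w ∘ σ + v) : ℝ) ^ l) ^ ρ

variable {ch ch' : BinaryChannel Y} {C : Submodule (ZMod 2) (Fin N → ZMod 2)} {τ : Y → Y}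
  {s : Y → ℝ≥0} {d : (Fin N → Y) → (Fin N → ZMod 2) → ℝ}

theorem errorIntegrand_nonneg (t l ρ : ℝ) (v : Fin N → ZMod 2) (σ : Equiv.Perm (Fin N))
    (y : Fin N → Y) : 0 ≤ errorIntegrand ch C t l ρ v σ y :=
  mul_nonneg (by positivity) (Real.rpow_nonneg (Finset.sum_nonneg fun _ _ => by positivity) _)

theorem measurable_errorIntegrand (t l ρ : ℝ) (v : Fin N → ZMod 2) (σ : Equiv.Perm (Fin N)) :
    Measurable (errorIntegrand ch C t l ρ v σ) := by
  unfold errorIntegrand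
  have h (c : Fin N → ZMod 2) : Measurable fun y : Fin N → Y => ch.likelihood y c :=
    ch.measurable_likelihood c
  fun_prop

/-- Permuting the output block by `σ` and then applying `τ` where `v` is `1` preserves the reference
measure and carries the likelihood of `c` to that of `c ∘ σ + v`. The word `v` need not be a
codeword. -/
theorem lintegral_errorIntegrand_eq (h : ch.IsSymmetricUnder τ) (t l ρ : ℝ)
    (v : Fin N → ZMod 2) (σ : Equiv.Perm (Fin N)) :
    ∫⁻ y, ENNReal.ofReal (errorIntegrand ch C t l ρ v σ y) ∂ch.blockRef N =
      ∫⁻ y, ENNReal.ofReal (errorIntegrand ch C t l ρ 0 1 y) ∂ch.blockRef N := by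
  have hm := (h.measurePreserving_translate v).comp (ch.measurePreserving_comp_perm σ)
  rw [← hm.lintegral_comp (measurable_errorIntegrand t l ρ v σ).ennreal_ofReal]
  refine lintegral_congr fun y => ?_
  have h1 (c : Fin N → ZMod 2) :
      ch.likelihood (BinaryChannel.translate τ v (y ∘ σ)) (c ∘ σ + v) = ch.likelihood y c := by
    rw [h.likelihood_translate, ch.likelihood_comp_perm]
  have h0 : ch.likelihood (BinaryChannel.translate τ v (y ∘ σ)) v = ch.likelihood y 0 := by
    rw [← h1 0]
    congr 1
    ext i
    simp
  simp only [errorIntegrand, Function.comp_apply, h0, h1, Equiv.Perm.coe_one,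
    Function.comp_id, add_zero]

/-- The sum runs over all of `F_2^N`, so it factors over the coordinates. -/
theorem sum_likelihood_rpow (ch : BinaryChannel Y) (ρ : ℝ) (y : Fin N → Y) :
    ((∑ u, (ch.likelihood y u : ℝ) ^ (1 / (1 + ρ))) / 2 ^ N) ^ (1 + ρ) =
      ∏ i, ch.gallagerIntegrand ρ uniformInput (y i) := by
  have h1 : (∑ u, (ch.likelihood y u : ℝ) ^ (1 / (1 + ρ))) / 2 ^ N =
      ∏ i, ∑ x, uniformInput x * (ch.dens x (y i) : ℝ) ^ (1 / (1 + ρ)) := by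
    rw [Finset.prod_univ_sum, Fintype.piFinset_univ, Finset.sum_div]
    refine Finset.sum_congr rfl fun u _ => ?_
    rw [Finset.prod_mul_distrib, Real.finsetProd_rpow _ _ fun i _ => NNReal.coe_nonneg _,
      BinaryChannel.likelihood, NNReal.coe_prod]
    simp [uniformInput]
    ring
  rw [h1, ← Real.finsetProd_rpow _ _ fun i _ => Finset.sum_nonneg fun x _ =>
    mul_nonneg (uniformInput_mem_stdSimplex.1 x) (by positivity)]
  rfl

theorem lintegral_prod_gallagerIntegrand (ch : BinaryChannel Y) {ρ : ℝ} (hρ : 0 ≤ ρ) :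
    ∫⁻ y, ENNReal.ofReal (∏ i, ch.gallagerIntegrand ρ uniformInput (y i)) ∂ch.blockRef N =
      ENNReal.ofReal (Real.exp (-N * ch.gallagerE0 ρ uniformInput)) := by
  have h0 (y : Y) := ch.gallagerIntegrand_nonneg (ρ := ρ) uniformInput_mem_stdSimplex.1 y
  have h1 : ∫⁻ y, ENNReal.ofReal (ch.gallagerIntegrand ρ uniformInput y) ∂ch.ref =
      ENNReal.ofReal (Real.exp (-ch.gallagerE0 ρ uniformInput)) := by
    rw [ch.exp_neg_gallagerE0 hρ, ofReal_integral_eq_lintegral_ofReal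
      (ch.integrable_gallagerIntegrand hρ uniformInput_mem_stdSimplex)
      (Filter.Eventually.of_forall h0)]
  simp_rw [ENNReal.ofReal_prod_of_nonneg fun i _ => h0 _]
  rw [BinaryChannel.blockRef, lintegral_pi_prod (fun _ : Fin N => ch.ref)
    (fun _ y => ENNReal.ofReal (ch.gallagerIntegrand ρ uniformInput y))
    fun _ => (ch.measurable_gallagerIntegrand ρ _).ennreal_ofReal]
  simp only [h1, Finset.prod_const, Finset.card_univ, Fintype.card_fin]
  rw [← ENNReal.ofReal_pow (Real.exp_nonneg _), ← Real.exp_nat_mul]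
  ring_nf

/-- The bound on the conditional error probability, with `M - 1` in place of `M`. -/
def errorBound (ch : BinaryChannel Y) (C : Submodule (ZMod 2) (Fin N → ZMod 2)) (r ρ' : ℝ) : ℝ :=
  ((codeSize C : ℝ) - 1) ^ (r * ρ') *
    Real.exp (ρ' * renyiDiv (conjOrder r) (spectrumPMF C) (binomialHalf N)) *
    Real.exp (-N * ch.gallagerE0 ρ' uniformInput)

theorem errorBound_nonneg (hC : C ≠ ⊥) (r ρ' : ℝ) : 0 ≤ errorBound ch C r ρ' :=
  mul_nonneg (mul_nonneg (Real.rpow_nonneg (codeSize_sub_one_pos hC).le _) (Real.exp_nonneg _))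
    (Real.exp_nonneg _)

/-- For fixed `y`, the sum over `σ` is handled by Jensen and Hölder, which leave `(B / 2^N)^ρ'` for
every `v`; the sum over `v` supplies one more factor `B`, completing the power `1 + ρ'`. -/
theorem sum_errorIntegrand_le (hC : C ≠ ⊥) {r ρ' : ℝ} (hr : 1 ≤ r) (hρ0 : 0 < ρ')
    (hρ1 : r * ρ' ≤ 1) (y : Fin N → Y) :
    ∑ v, ∑ σ, errorIntegrand ch C (1 / (1 + ρ')) (1 / (1 + ρ') / r) (r * ρ') v σ y ≤
      2 ^ N * N.factorial * (((codeSize C : ℝ) - 1) ^ (r * ρ') *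
        Real.exp (ρ' * renyiDiv (conjOrder r) (spectrumPMF C) (binomialHalf N)) *
        ∏ i, ch.gallagerIntegrand ρ' uniformInput (y i)) := by
  have hr0 : 0 < r := by linarith
  have h1ρ : 0 < 1 + ρ' := by linarith
  have hf : (0 : ℝ) < N.factorial := by exact_mod_cast N.factorial_pos
  set t := 1 / (1 + ρ') with ht
  set D := renyiDiv (conjOrder r) (spectrumPMF C) (binomialHalf N) with hD
  set B := ∑ u, (ch.likelihood y u : ℝ) ^ t with hB
  have hB0 : 0 ≤ B := Finset.sum_nonneg fun u _ => by positivity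
  have hM := codeSize_sub_one_pos hC
  -- The exponent `t / r` is chosen so that the `r`-th power from Hölder restores `t`; translating
  -- by `v` only reindexes the sum.
  have hshift (v : Fin N → ZMod 2) :
      ∑ u, ((ch.likelihood y (u + v) : ℝ) ^ (t / r)) ^ r = B := by
    rw [hB, ← Equiv.sum_comp (Equiv.addRight v) fun u => (ch.likelihood y u : ℝ) ^ t]
    refine Finset.sum_congr rfl fun u _ => ?_
    rw [← Real.rpow_mul (NNReal.coe_nonneg _), div_mul_cancel₀ _ hr0.ne']
    rfl
  have hv (v : Fin N → ZMod 2) :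
      ∑ σ, errorIntegrand ch C t (t / r) (r * ρ') v σ y ≤
        (ch.likelihood y v : ℝ) ^ t * (N.factorial *
          (((codeSize C : ℝ) - 1) * (Real.exp (D / r) * (B / 2 ^ N) ^ (1 / r))) ^ (r * ρ')) := by
    have := perm_average_rpow_le hC hr (by positivity) hρ1
      (φ := fun u => (ch.likelihood y (u + v) : ℝ) ^ (t / r)) fun u => by positivity
    rw [hshift, div_le_iff₀' hf] at this
    simp only [errorIntegrand]
    rw [← Finset.mul_sum]
    exact mul_le_mul_of_nonneg_left this (by positivity)
  refine (Finset.sum_le_sum fun v _ => hv v).trans_eq ?_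
  rw [← Finset.sum_mul, ← hB, ← sum_likelihood_rpow, ← ht, ← hB,
    Real.mul_rpow hM.le (by positivity), Real.mul_rpow (by positivity) (by positivity),
    ← Real.exp_mul, ← Real.rpow_mul (by positivity)]
  have e1 : D / r * (r * ρ') = ρ' * D := by field_simp
  have e2 : 1 / r * (r * ρ') = ρ' := by field_simp
  have e3 : (B / 2 ^ N) ^ (1 + ρ') = B / 2 ^ N * (B / 2 ^ N) ^ ρ' := by
    rw [Real.rpow_add' (by positivity) h1ρ.ne', Real.rpow_one]
  rw [e1, e2, e3]
  have : (2 : ℝ) ^ N ≠ 0 := by positivity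
  field_simp

theorem lintegral_errorIntegrand_le (hC : C ≠ ⊥) (h : ch.IsSymmetricUnder τ) {r ρ' : ℝ}
    (hr : 1 ≤ r) (hρ0 : 0 < ρ') (hρ1 : r * ρ' ≤ 1) (v : Fin N → ZMod 2) :
    ∫⁻ y, ENNReal.ofReal
        (errorIntegrand ch C (1 / (1 + ρ')) (1 / (1 + ρ') / r) (r * ρ') v 1 y) ∂ch.blockRef N ≤
      ENNReal.ofReal (errorBound ch C r ρ') := by
  rw [lintegral_errorIntegrand_eq h]
  set t := 1 / (1 + ρ') with ht
  set I := ∫⁻ y, ENNReal.ofReal (errorIntegrand ch C t (t / r) (r * ρ') 0 1 y) ∂ch.blockRef N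
    with hI
  have hK : 0 ≤ ((codeSize C : ℝ) - 1) ^ (r * ρ') *
      Real.exp (ρ' * renyiDiv (conjOrder r) (spectrumPMF C) (binomialHalf N)) :=
    mul_nonneg (Real.rpow_nonneg (codeSize_sub_one_pos hC).le _) (Real.exp_nonneg _)
  have hc : (0 : ℝ) < 2 ^ N * N.factorial := by
    have : (0 : ℝ) < N.factorial := by exact_mod_cast N.factorial_pos
    positivity
  have hsum : ENNReal.ofReal (2 ^ N * N.factorial) * I =
      ∫⁻ y, ENNReal.ofReal (∑ v, ∑ σ, errorIntegrand ch C t (t / r) (r * ρ') v σ y)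
        ∂ch.blockRef N := by
    simp_rw [ENNReal.ofReal_sum_of_nonneg fun v _ => Finset.sum_nonneg fun σ _ =>
      errorIntegrand_nonneg t (t / r) (r * ρ') v σ _,
      ENNReal.ofReal_sum_of_nonneg fun σ _ => errorIntegrand_nonneg t (t / r) (r * ρ') _ σ _]
    rw [lintegral_finsetSum _ fun v _ => Finset.measurable_sum _ fun σ _ =>
      (measurable_errorIntegrand _ _ _ v σ).ennreal_ofReal]
    simp_rw [lintegral_finsetSum _ fun σ _ =>
      (measurable_errorIntegrand _ _ _ _ σ).ennreal_ofReal, lintegral_errorIntegrand_eq h]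
    simp only [Finset.sum_const, Finset.card_univ, Fintype.card_perm, Fintype.card_fin,
      nsmul_eq_mul, Fintype.card_pi, ZMod.card, Finset.prod_const]
    rw [← mul_assoc, ENNReal.ofReal_mul (by positivity), ENNReal.ofReal_natCast,
      ENNReal.ofReal_pow (by norm_num)]
    simp [hI]
  have hle : ENNReal.ofReal (2 ^ N * N.factorial) * I ≤
      ENNReal.ofReal (2 ^ N * N.factorial) * ENNReal.ofReal (errorBound ch C r ρ') := by
    rw [hsum]
    refine (lintegral_mono fun y => ENNReal.ofReal_le_ofReal
      (sum_errorIntegrand_le hC hr hρ0 hρ1 y)).trans_eq ?_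
    simp_rw [ENNReal.ofReal_mul hc.le, ENNReal.ofReal_mul hK]
    rw [lintegral_const_mul' _ _ ENNReal.ofReal_ne_top,
      lintegral_const_mul' _ _ ENNReal.ofReal_ne_top,
      lintegral_prod_gallagerIntegrand ch hρ0.le, ← ENNReal.ofReal_mul hK]
    rfl
  exact (ENNReal.mul_le_mul_iff_right (ENNReal.ofReal_pos.2 hc).ne' ENNReal.ofReal_ne_top).1 hle

/-! ### Maximum-likelihood decoders -/

theorem IsMLDecoder.le_one (hd : IsMLDecoder ch C d) (y : Fin N → Y) (c : Fin N → ZMod 2) :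
    d y c ≤ 1 := by
  rw [← hd.sum_eq_one y]
  exact Finset.single_le_sum (fun c _ => hd.nonneg y c) (Finset.mem_univ c)

theorem IsMLDecoder.integrable (hd : IsMLDecoder ch C d) (c c' : Fin N → ZMod 2) :
    Integrable (fun y => d y c) (ch.blockLaw c') :=
  Integrable.of_bound (hd.measurable c).aestronglyMeasurable 1
    (Filter.Eventually.of_forall fun y => by
      rw [Real.norm_of_nonneg (hd.nonneg y c)]; exact hd.le_one y c)

theorem IsMLDecoder.ofReal_condErrorProb (hd : IsMLDecoder ch C d) (c : Fin N → ZMod 2) :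
    ENNReal.ofReal (condErrorProb ch d c) =
      ∫⁻ y, ENNReal.ofReal (1 - d y c) ∂ch.blockLaw c :=
  ofReal_integral_eq_lintegral_ofReal ((integrable_const 1).sub (hd.integrable c c))
    (Filter.Eventually.of_forall fun y => sub_nonneg.2 (hd.le_one y c))

/-- Unless the decoder outputs `c` with certainty, some other codeword is at least as likely, and
its term alone makes the sum at least `p(y|c)^l`. The condition `t + l ρ = 1` then reassembles
`p(y|c)`. -/
theorem likelihood_mul_le_errorIntegrand (hd : IsMLDecoder ch C d) {c : Fin N → ZMod 2}
    (hc : c ∈ C) {y : Fin N → Y} (hy : ∀ c', IsMostLikely ch C y c' → IsMostLikely ch' C y c')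
    {t l ρ : ℝ} (hl : 0 ≤ l) (hρ : 0 ≤ ρ) (htl : t + l * ρ = 1) :
    ch'.likelihood y c * (1 - d y c) ≤ errorIntegrand ch' C t l ρ c 1 y := by
  have h0 := errorIntegrand_nonneg (ch := ch') (C := C) t l ρ c 1 y
  by_cases h1 : d y c = 1
  · rwa [h1, sub_self, mul_zero]
  · obtain ⟨c', hne, hc'⟩ : ∃ c', c' ≠ c ∧ d y c' ≠ 0 := by
      by_contra! H
      refine h1 ?_
      rw [← hd.sum_eq_one y, Finset.sum_eq_single c (fun b _ hb => H b hb) (by simp)]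
    have hML := hy c' (hd.mostLikely y c' hc')
    have hle : (ch'.likelihood y c : ℝ) ≤ ch'.likelihood y c' := by exact_mod_cast hML.2 c hc
    have hmem : c' - c ∈ (codewords C).erase 0 :=
      Finset.mem_erase.2 ⟨sub_ne_zero.2 hne, mem_codewords.2 (C.sub_mem hML.1 hc)⟩
    have hsum : (ch'.likelihood y c : ℝ) ^ l ≤ ∑ w ∈ (codewords C).erase 0,
        (ch'.likelihood y (w ∘ (1 : Equiv.Perm (Fin N)) + c) : ℝ) ^ l := by
      refine le_trans ?_ (Finset.single_le_sum (fun _ _ => by positivity) hmem)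
      simpa using Real.rpow_le_rpow (by positivity) hle hl
    calc
      ch'.likelihood y c * (1 - d y c) ≤ ch'.likelihood y c * 1 :=
        mul_le_mul_of_nonneg_left (by linarith [hd.nonneg y c]) (by positivity)
      _ = (ch'.likelihood y c : ℝ) ^ t * ((ch'.likelihood y c : ℝ) ^ l) ^ ρ := by
        rw [← Real.rpow_mul (by positivity), ← Real.rpow_add' (by positivity) (by simp [htl]),
          htl, Real.rpow_one, mul_one]
      _ ≤ _ := mul_le_mul_of_nonneg_left (Real.rpow_le_rpow (by positivity) hsum hρ)
        (by positivity)

theorem condErrorProb_le (hC : C ≠ ⊥) (hs : ch'.IsRescaling ch s) (hτ : ch'.IsSymmetricUnder τ)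
    (hd : IsMLDecoder ch C d) {c : Fin N → ZMod 2} (hc : c ∈ C) {r ρ' : ℝ}
    (hr : 1 ≤ r) (hρ0 : 0 < ρ') (hρ1 : r * ρ' ≤ 1) :
    condErrorProb ch d c ≤ errorBound ch' C r ρ' := by
  rw [← ENNReal.ofReal_le_ofReal_iff (errorBound_nonneg hC _ _), hd.ofReal_condErrorProb]
  refine le_trans ?_ (lintegral_errorIntegrand_le hC hτ hr hρ0 hρ1 c)
  have hae := hs.ae_isMostLikely_iff C c
  have hL := (ch'.measurable_likelihood c).coe_nnreal_ennreal
  have hdm : Measurable fun y => ENNReal.ofReal (1 - d y c) :=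
    (measurable_const.sub (hd.measurable c)).ennreal_ofReal
  rw [← hs.blockLaw_eq, BinaryChannel.blockLaw_eq_withDensity, ae_withDensity_iff hL] at hae
  rw [← hs.blockLaw_eq, BinaryChannel.blockLaw_eq_withDensity,
    lintegral_withDensity_eq_lintegral_mul _ hL hdm]
  refine lintegral_mono_ae ?_
  filter_upwards [hae] with y hy
  rw [Pi.mul_apply, ← ENNReal.ofReal_coe_nnreal, ← ENNReal.ofReal_mul (NNReal.coe_nonneg _)]
  refine ENNReal.ofReal_le_ofReal ?_
  -- The two descriptions agree on the most likely words almost surely under the law of `c`, hence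
  -- only where this likelihood is nonzero; elsewhere the left side vanishes.
  by_cases h0 : ch'.likelihood y c = 0
  · rw [h0, NNReal.coe_zero, zero_mul]
    exact errorIntegrand_nonneg _ _ _ _ _ _
  · have hr0 : 0 < r := by linarith
    have h1ρ : 0 < 1 + ρ' := by linarith
    refine likelihood_mul_le_errorIntegrand hd hc (fun c' => (hy (by simpa using h0) c').1)
      (by positivity) (by positivity) ?_
    field_simp

theorem blockErrorProb_le (hC : C ≠ ⊥) (hs : ch'.IsRescaling ch s) (hτ : ch'.IsSymmetricUnder τ)
    (hd : IsMLDecoder ch C d) {r ρ' : ℝ}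
    (hr : 1 ≤ r) (hρ0 : 0 < ρ') (hρ1 : r * ρ' ≤ 1) :
    blockErrorProb ch C d ≤ errorBound ch' C r ρ' := by
  have hM : (0 : ℝ) < codeSize C := by linarith [codeSize_sub_one_pos hC]
  rw [blockErrorProb, div_le_iff₀' hM, codeSize, ← nsmul_eq_mul]
  exact Finset.sum_le_card_nsmul _ _ _ fun c hc =>
    condErrorProb_le hC hs hτ hd (mem_codewords.1 hc) hr hρ0 hρ1

/-- The decoded word is always at least as likely as the zero word, whose likelihood integrates to
one. So the probabilities of correct decoding add up to at least one over the code, and `P_e ≤ 1 -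
1/M`. -/
theorem blockErrorProb_lt_one (hd : IsMLDecoder ch C d) : blockErrorProb ch C d < 1 := by
  have hM : (0 : ℝ) < codeSize C := by
    exact_mod_cast Finset.card_pos.2 ⟨0, zero_mem_codewords⟩
  have hL (c : Fin N → ZMod 2) := (ch.measurable_likelihood c).coe_nnreal_ennreal
  have hdm (c : Fin N → ZMod 2) := (hd.measurable c).ennreal_ofReal
  have hcorrect : (1 : ℝ≥0∞) ≤
      ∑ c ∈ codewords C, ∫⁻ y, ENNReal.ofReal (d y c) ∂ch.blockLaw c := by
    calc
      (1 : ℝ≥0∞) = ∫⁻ y, (ch.likelihood y 0 : ℝ≥0∞) ∂ch.blockRef N := by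
        have : ch.blockLaw (0 : Fin N → ZMod 2) Set.univ = 1 := measure_univ
        rw [BinaryChannel.blockLaw_eq_withDensity, withDensity_apply _ MeasurableSet.univ,
          Measure.restrict_univ] at this
        exact this.symm
      _ ≤ ∫⁻ y, ∑ c ∈ codewords C, (ch.likelihood y c : ℝ≥0∞) * ENNReal.ofReal (d y c)
            ∂ch.blockRef N := by
        refine lintegral_mono fun y => ?_
        have hsum : ∑ c ∈ codewords C, ENNReal.ofReal (d y c) = 1 := by
          rw [← ENNReal.ofReal_sum_of_nonneg fun c _ => hd.nonneg y c,
            Finset.sum_subset (Finset.subset_univ _), hd.sum_eq_one, ENNReal.ofReal_one]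
          intro c _ hc
          by_contra h
          exact hc (mem_codewords.2 (hd.mostLikely y c h).1)
        rw [← mul_one (ch.likelihood y 0 : ℝ≥0∞), ← hsum, Finset.mul_sum]
        refine Finset.sum_le_sum fun c _ => ?_
        by_cases h : d y c = 0
        · simp [h]
        · gcongr
          exact (hd.mostLikely y c h).2 0 C.zero_mem
      _ = _ := by
        have hm (c : Fin N → ZMod 2) : Measurable fun y =>
            (ch.likelihood y c : ℝ≥0∞) * ENNReal.ofReal (d y c) := (hL c).mul (hdm c)
        rw [lintegral_finsetSum _ fun c _ => hm c]
        refine Finset.sum_congr rfl fun c _ => ?_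
        rw [BinaryChannel.blockLaw_eq_withDensity,
          lintegral_withDensity_eq_lintegral_mul _ (hL c) (hdm c)]
        rfl
  have hcorrect' : (1 : ℝ) ≤ ∑ c ∈ codewords C, ∫ y, d y c ∂ch.blockLaw c := by
    have h1 (c : Fin N → ZMod 2) : ∫⁻ y, ENNReal.ofReal (d y c) ∂ch.blockLaw c =
        ENNReal.ofReal (∫ y, d y c ∂ch.blockLaw c) :=
      (ofReal_integral_eq_lintegral_ofReal (hd.integrable c c)
        (Filter.Eventually.of_forall fun y => hd.nonneg y c)).symm
    simp_rw [h1] at hcorrect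
    rwa [← ENNReal.ofReal_sum_of_nonneg fun c _ => integral_nonneg fun y => hd.nonneg y c,
      ENNReal.one_le_ofReal] at hcorrect
  have hcond (c : Fin N → ZMod 2) :
      condErrorProb ch d c = 1 - ∫ y, d y c ∂ch.blockLaw c := by
    rw [condErrorProb, integral_sub (integrable_const 1) (hd.integrable c c)]
    simp
  rw [blockErrorProb, div_lt_one hM, Finset.sum_congr rfl fun c _ => hcond c,
    Finset.sum_sub_distrib, Finset.sum_const, nsmul_one]
  exact (sub_lt_self _ (by linarith))

open Classical in
theorem IsMLDecoder.eq_inv_card (hd : IsMLDecoder ch C d) {y : Fin N → Y}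
    (hy : ∀ c₁ c₂, IsMostLikely ch C y c₁ → IsMostLikely ch C y c₂ → d y c₁ = d y c₂)
    (c : Fin N → ZMod 2) :
    d y c = if IsMostLikely ch C y c then
      ((Finset.univ.filter fun c => IsMostLikely ch C y c).card : ℝ)⁻¹ else 0 := by
  split_ifs with h
  · refine eq_inv_of_mul_eq_one_right ?_
    rw [← hd.sum_eq_one y, ← Finset.sum_subset (Finset.filter_subset
      (fun c => IsMostLikely ch C y c) _), Finset.sum_congr rfl fun c' hc' =>
      hy c' c (Finset.mem_filter.1 hc').2 h, Finset.sum_const, nsmul_eq_mul]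
    intro c' _ hc'
    by_contra h'
    exact hc' (Finset.mem_filter.2 ⟨Finset.mem_univ _, hd.mostLikely y c' h'⟩)
  · by_contra h'
    exact h (hd.mostLikely y c h')

/-- Translation by `c` carries the block law of `0` to that of `c` and maps the set of most likely
codewords bijectively. Uniform tie-breaking makes the decoder depend only on that set and its size.
-/
theorem condErrorProb_eq_zero_word (hs : ch'.IsRescaling ch s) (hτ : ch'.IsSymmetricUnder τ)
    (hd : IsMLDecoder ch C d) (hu : ResolvesTiesUniformly ch C d) {c : Fin N → ZMod 2}
    (hc : c ∈ C) : condErrorProb ch d c = condErrorProb ch d 0 := by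
  classical
  have hmp : MeasurePreserving (BinaryChannel.translate τ c) (ch.blockLaw 0) (ch.blockLaw c) := by
    simpa only [hs.blockLaw_eq] using hτ.measurePreserving_blockLaw c
  have hdm : Measurable fun y => 1 - d y c := measurable_const.sub (hd.measurable c)
  rw [condErrorProb, condErrorProb, ← hmp.map_eq, integral_map hmp.measurable.aemeasurable
    hdm.aestronglyMeasurable]
  refine integral_congr_ae ?_
  filter_upwards [hu 0 C.zero_mem, hs.ae_isMostLikely_iff C 0,
    hmp.quasiMeasurePreserving.ae (hu c hc),
    hmp.quasiMeasurePreserving.ae (hs.ae_isMostLikely_iff C c)] with y h1 h2 h3 h4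
  have hiff (c' : Fin N → ZMod 2) :
      IsMostLikely ch C (BinaryChannel.translate τ c y) (c' + c) ↔ IsMostLikely ch C y c' := by
    rw [h4, h2, hτ.isMostLikely_translate hc]
  have hcard : (Finset.univ.filter fun c' =>
      IsMostLikely ch C (BinaryChannel.translate τ c y) c').card =
      (Finset.univ.filter fun c' => IsMostLikely ch C y c').card :=
    (Finset.card_equiv (Equiv.addRight c) fun c' => by simp [hiff]).symm
  have h0 := hiff 0
  rw [zero_add] at h0
  rw [hd.eq_inv_card h1, hd.eq_inv_card h3, hcard]
  simp only [h0]

theorem blockErrorProb_eq_zero_word (hs : ch'.IsRescaling ch s) (hτ : ch'.IsSymmetricUnder τ)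
    (hd : IsMLDecoder ch C d) (hu : ResolvesTiesUniformly ch C d) :
    blockErrorProb ch C d = condErrorProb ch d 0 := by
  have hM : (codeSize C : ℝ) ≠ 0 := by
    exact_mod_cast (Finset.card_pos.2 ⟨0, zero_mem_codewords⟩).ne'
  rw [blockErrorProb, Finset.sum_congr rfl fun c hc =>
    condErrorProb_eq_zero_word hs hτ hd hu (mem_codewords.1 hc), Finset.sum_const, nsmul_eq_mul]
  exact mul_div_cancel_left₀ _ hM

end

section

variable {Y : Type*} [MeasurableSpace Y] {N : ℕ}
  {ch ch' : BinaryChannel Y} {C : Submodule (ZMod 2) (Fin N → ZMod 2)} {τ : Y → Y}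
  {s : Y → ℝ≥0} {d : (Fin N → Y) → (Fin N → ZMod 2) → ℝ}

/-! ### The error exponent -/

theorem rate_nonneg (C : Submodule (ZMod 2) (Fin N → ZMod 2)) : 0 ≤ rate C :=
  div_nonneg (Real.log_natCast_nonneg _) (Nat.cast_nonneg _)

/-- The subtracted rate and divergence terms are nonnegative. Read backwards, a large exponent
forces a large `ρ'`. -/
theorem exponent_le (hC : C ≠ ⊥) {r ρ' : ℝ} (hr : 1 ≤ r) (hρ : 0 ≤ ρ') :
    exponent ch C r ρ' ≤ ρ' * Real.log 2 := by
  have h1 : 0 ≤ r * rate C + renyiDiv (conjOrder r) (spectrumPMF C) (binomialHalf N) / N :=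
    add_nonneg (mul_nonneg (by linarith) (rate_nonneg C))
      (div_nonneg (renyiDiv_conjOrder_nonneg hC hr) (Nat.cast_nonneg _))
  have h2 := mul_nonneg hρ h1
  have h3 := ch.gallagerE0_le hρ
  rw [exponent]
  linarith

theorem continuousOn_exponent (ch : BinaryChannel Y) (C : Submodule (ZMod 2) (Fin N → ZMod 2))
    (r : ℝ) : ContinuousOn (exponent ch C r) (Set.Ici 0) :=
  ch.continuousOn_gallagerE0.sub (continuousOn_id.mul continuousOn_const)

theorem exists_isGreatest_exponent (ch : BinaryChannel Y)
    (C : Submodule (ZMod 2) (Fin N → ZMod 2)) {r : ℝ} (hr : 1 ≤ r) :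
    ∃ x, IsGreatest ((fun ρ' : ℝ => exponent ch C r ρ') '' Set.Icc 0 (1 / r)) x :=
  (isCompact_Icc.image_of_continuousOn ((continuousOn_exponent ch C r).mono
    Set.Icc_subset_Ici_self)).exists_isGreatest
    ((Set.nonempty_Icc.2 (one_div_nonneg.2 (by linarith))).image _)

theorem errorBound_eq (hC : C ≠ ⊥) (r ρ' : ℝ) :
    errorBound ch C r ρ' = (((codeSize C : ℝ) - 1) / codeSize C) ^ (r * ρ') *
      Real.exp (-N * exponent ch C r ρ') := by
  have hM1 := codeSize_sub_one_pos hC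
  have hM : (0 : ℝ) < codeSize C := by linarith
  have hN : (N : ℝ) ≠ 0 := by exact_mod_cast (length_pos hC).ne'
  have hMr : (codeSize C : ℝ) ^ (r * ρ') ≠ 0 := (Real.rpow_pos_of_pos hM _).ne'
  have hexp : Real.exp (-N * exponent ch C r ρ') = (codeSize C : ℝ) ^ (r * ρ') *
      (Real.exp (ρ' * renyiDiv (conjOrder r) (spectrumPMF C) (binomialHalf N)) *
        Real.exp (-N * ch.gallagerE0 ρ' uniformInput)) := by
    rw [Real.rpow_def_of_pos hM, ← Real.exp_add, ← Real.exp_add, exponent, rate]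
    congr 1
    field_simp
    ring
  rw [hexp, Real.div_rpow hM1.le hM.le, errorBound]
  field_simp

/-- The error probability lies below the exponential bound by a factor which is bounded away
from `1` as long as the exponent is bounded away from `0`. -/
theorem blockErrorProb_le_mul_exp (hC : C ≠ ⊥) (hch : ch.IsOutputSymmetric)
    (hd : IsMLDecoder ch C d) {r ρ' δ : ℝ} (hr : 1 ≤ r) (hρ : ρ' ∈ Set.Icc 0 (1 / r))
    (hδ : 0 < δ) (hδρ : δ ≤ ρ') :
    blockErrorProb ch C d ≤ (((codeSize C : ℝ) - 1) / codeSize C) ^ δ *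
      Real.exp (-N * exponent ch C r ρ') := by
  obtain ⟨ch', s, τ, hs, hτ⟩ := ch.exists_isRescaling hch
  have hM1 := codeSize_sub_one_pos hC
  have hM : (0 : ℝ) < codeSize C := by linarith
  have hρ0 : 0 < ρ' := hδ.trans_le hδρ
  have hρ1 : r * ρ' ≤ 1 := by
    rw [mul_comm]; exact (le_div_iff₀ (by linarith)).1 hρ.2
  have hδr : δ ≤ r * ρ' := hδρ.trans (le_mul_of_one_le_left hρ0.le hr)
  refine (blockErrorProb_le hC hs hτ hd hr hρ0 hρ1).trans ?_
  have hexp : exponent ch' C r ρ' = exponent ch C r ρ' := by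
    rw [exponent, exponent, hs.gallagerE0_eq hρ0.le uniformInput_mem_stdSimplex.1]
  rw [errorBound_eq hC, hexp]
  exact mul_le_mul_of_nonneg_right (Real.rpow_le_rpow_of_exponent_ge (div_pos hM1 hM)
    ((div_le_one hM).2 (by linarith)) hδr) (Real.exp_nonneg _)

/-- A strict bound at each pair `(r, ρ')` could degenerate to equality at an unattained supremum. A
factor `q < 1` independent of the pair survives the limit. -/
theorem blockErrorProb_lt_exp (hC : C ≠ ⊥) (hch : ch.IsOutputSymmetric)
    (hd : IsMLDecoder ch C d) {Emax : ℝ → ℝ} {E : ℝ}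
    (hmax : ∀ r : ℝ, 1 ≤ r →
      IsGreatest ((fun ρ' : ℝ => exponent ch C r ρ') '' Set.Icc 0 (1 / r)) (Emax r))
    (hE : IsLUB (Emax '' Set.Ici 1) E) :
    blockErrorProb ch C d < Real.exp (-(N : ℝ) * E) := by
  rcases le_or_gt E 0 with hE0 | hE0
  · refine (blockErrorProb_lt_one hd).trans_le (Real.one_le_exp ?_)
    exact mul_nonneg_of_nonpos_of_nonpos (by simp) hE0
  · have hlog : 0 < Real.log 2 := Real.log_pos (by norm_num)
    have hM1 := codeSize_sub_one_pos hC
    have hM : (0 : ℝ) < codeSize C := by linarith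
    -- By `exponent_le`, any exponent above `E / 2` has `ρ' ≥ δ`.
    set δ := E / 2 / Real.log 2 with hδ
    have hδ0 : 0 < δ := by positivity
    set q := (((codeSize C : ℝ) - 1) / codeSize C) ^ δ with hq
    have hq0 : 0 ≤ q := Real.rpow_nonneg (div_pos hM1 hM).le _
    have hq1 : q < 1 :=
      Real.rpow_lt_one (div_pos hM1 hM).le ((div_lt_one hM).2 (by linarith)) hδ0
    have hbelow (x : ℝ) (hx : x < E) : blockErrorProb ch C d ≤ q * Real.exp (-N * x) := by
      -- An exponent exceeding both `x` and `E / 2` is chosen: the first gives the bound at `x`, the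
      -- second the lower bound on `ρ'`.
      obtain ⟨_, ⟨r, hr, rfl⟩, hlt⟩ :=
        (lt_isLUB_iff hE).1 (max_lt hx (half_lt_self hE0))
      obtain ⟨ρ', hρ, hρE⟩ := (hmax r hr).1
      rw [← hρE] at hlt
      obtain ⟨hx', hE'⟩ := max_lt_iff.1 hlt
      have hδρ : δ ≤ ρ' := by
        rw [hδ, div_le_iff₀ hlog]
        exact hE'.le.trans (exponent_le hC hr hρ.1)
      refine (blockErrorProb_le_mul_exp hC hch hd hr hρ hδ0 hδρ).trans ?_
      refine mul_le_mul_of_nonneg_left (Real.exp_le_exp.2 ?_) hq0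
      exact mul_le_mul_of_nonpos_left hx'.le (by simp)
    have hlim : Filter.Tendsto (fun x : ℝ => q * Real.exp (-N * x)) (nhdsWithin E (Set.Iio E))
        (nhds (q * Real.exp (-N * E))) :=
      ((by fun_prop : Continuous fun x : ℝ => q * Real.exp (-N * x)).tendsto E).mono_left
        nhdsWithin_le_nhds
    have hle : blockErrorProb ch C d ≤ q * Real.exp (-N * E) :=
      ge_of_tendsto hlim (Filter.eventually_of_mem self_mem_nhdsWithin hbelow)
    exact hle.trans_lt (mul_lt_of_lt_one_left (Real.exp_pos _) hq1)

theorem exists_isLUB_exponent (hC : C ≠ ⊥) {Emax : ℝ → ℝ}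
    (hmax : ∀ r : ℝ, 1 ≤ r →
      IsGreatest ((fun ρ' : ℝ => exponent ch C r ρ') '' Set.Icc 0 (1 / r)) (Emax r)) :
    ∃ E, IsLUB (Emax '' Set.Ici 1) E := by
  refine ⟨_, isLUB_csSup (Set.nonempty_Ici.image _) ⟨Real.log 2, ?_⟩⟩
  rintro _ ⟨r, hr, rfl⟩
  have hr : 1 ≤ r := hr
  obtain ⟨ρ', hρ, hρE⟩ := (hmax r hr).1
  have hρ1 : ρ' ≤ 1 := hρ.2.trans ((div_le_one (by linarith)).2 hr)
  rw [← hρE]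
  exact (exponent_le hC hr hρ.1).trans
    (mul_le_of_le_one_left (Real.log_nonneg (by norm_num)) hρ1)

/-- At `r = 1` the order is infinite and the divergence is the logarithm of the largest ratio. The
maximum over `q` adds nothing because the uniform input is optimal for each `ρ`. -/
theorem isGreatest_gallager_exponent (hch : ch.IsOutputSymmetric) {E : ℝ}
    (hmax : IsGreatest ((fun ρ' : ℝ => exponent ch C 1 ρ') '' Set.Icc 0 (1 / 1)) E) :
    IsGreatest ((fun t : ℝ × (ZMod 2 → ℝ) => ch.gallagerE0 t.1 t.2 -
      t.1 * (rate C + Real.log (⨆ l, spectrumRatio C l) / N)) ''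
        (Set.Icc 0 1 ×ˢ stdSimplex ℝ (ZMod 2))) E := by
  obtain ⟨ch', s, τ, hs, hτ⟩ := ch.exists_isRescaling hch
  have hexp (ρ : ℝ) : exponent ch C 1 ρ = ch.gallagerE0 ρ uniformInput -
      ρ * (rate C + Real.log (⨆ l, spectrumRatio C l) / N) := by
    rw [exponent, renyiDiv_conjOrder_one, one_mul]
  rw [div_one] at hmax
  constructor
  · obtain ⟨ρ, hρ, hE⟩ := hmax.1
    exact ⟨(ρ, uniformInput), ⟨hρ, uniformInput_mem_stdSimplex⟩, by rw [← hE]; exact (hexp ρ).symm⟩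
  · rintro _ ⟨⟨ρ, q⟩, ⟨hρ, hq⟩, rfl⟩
    refine le_trans ?_ (hmax.2 ⟨ρ, hρ, rfl⟩)
    have := hτ.gallagerE0_le_uniformInput hρ.1 hq
    rw [hs.gallagerE0_eq hρ.1 hq.1, hs.gallagerE0_eq hρ.1 uniformInput_mem_stdSimplex.1] at this
    simp only [hexp]
    linarith

end

end LinearCodeBound

end

theorem theorem2 {N : ℕ} (C : Submodule (ZMod 2) (Fin N → ZMod 2)) (hC : C ≠ ⊥)
    {Y : Type*} [MeasurableSpace Y] (ch : LinearCodeBound.BinaryChannel Y)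
    (hch : ch.IsOutputSymmetric) :
    ∃ (Emax : ℝ → ℝ) (E : ℝ),
      -- `Emax r` is the maximum over `0 ≤ ρ' ≤ 1 / r`, and `E` the supremum over `r ≥ 1`
      (∀ r : ℝ, 1 ≤ r → IsGreatest
        ((fun ρ' : ℝ => LinearCodeBound.exponent ch C r ρ') '' Set.Icc 0 (1 / r)) (Emax r)) ∧
      IsLUB (Emax '' Set.Ici 1) E ∧
      -- the bound `P_e = P_{e|0} < exp (-N E)`
      (∀ d : (Fin N → Y) → (Fin N → ZMod 2) → ℝ, LinearCodeBound.IsMLDecoder ch C d →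
        LinearCodeBound.blockErrorProb ch C d < Real.exp (-(N : ℝ) * E) ∧
        (LinearCodeBound.ResolvesTiesUniformly ch C d →
          LinearCodeBound.blockErrorProb ch C d = LinearCodeBound.condErrorProb ch d 0)) ∧
      -- for `r = 1`, the exponent is Gallager's random coding exponent at the rate
      -- `R + log (max_l P_N(l) / Q_N(l)) / N`, which gives the Shulman-Feder bound
      IsGreatest
        ((fun t : ℝ × (ZMod 2 → ℝ) => ch.gallagerE0 t.1 t.2 -
          t.1 * (LinearCodeBound.rate C + Real.log (⨆ l : Fin (N + 1),
            LinearCodeBound.spectrumPMF C l / LinearCodeBound.binomialHalf N l) / N)) ''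
          (Set.Icc 0 1 ×ˢ stdSimplex ℝ (ZMod 2))) (Emax 1) ∧
      (∀ d : (Fin N → Y) → (Fin N → ZMod 2) → ℝ, LinearCodeBound.IsMLDecoder ch C d →
        LinearCodeBound.blockErrorProb ch C d < Real.exp (-(N : ℝ) * Emax 1)) := by
  
  choose! Emax hmax using fun (r : ℝ) (hr : 1 ≤ r) =>
    LinearCodeBound.exists_isGreatest_exponent ch C hr
  obtain ⟨E, hE⟩ := LinearCodeBound.exists_isLUB_exponent hC hmax
  have hlt (d : (Fin N → Y) → (Fin N → ZMod 2) → ℝ) (hd : LinearCodeBound.IsMLDecoder ch C d) :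
      LinearCodeBound.blockErrorProb ch C d < Real.exp (-(N : ℝ) * E) :=
    LinearCodeBound.blockErrorProb_lt_exp hC hch hd hmax hE
  refine ⟨Emax, E, hmax, hE, fun d hd => ⟨hlt d hd, fun hu => ?_⟩,
    LinearCodeBound.isGreatest_gallager_exponent hch (hmax 1 le_rfl),
    fun d hd => (hlt d hd).trans_le (Real.exp_le_exp.2 ?_)⟩
  · obtain ⟨ch', s, τ, hs, hτ⟩ := ch.exists_isRescaling hch
    exact LinearCodeBound.blockErrorProb_eq_zero_word hs hτ hd hu
  · exact mul_le_mul_of_nonpos_left (hE.1 ⟨1, le_refl (1 : ℝ), rfl⟩) (by simp)
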